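/- Let $N\ge 2$, $0\le\lambda\le N$ and $c,\varepsilon\in\{-1,1\}$. Let $\mathbb{E}$ be $\mathbb{R}^{N+1}$ with its standard flat scalar product $g_0$ of index $\lambda$ if $c=1$ and of index $\lambda+1$ if $c=-1$, and let $\mathbb{M}^N_\lambda(c)$ be a connected component of $\{p\in\mathbb{E} : g_0(p,p)=c\}$, with the metric $g$ induced by $g_0$. Let $I\subset\mathbb{R}$ be an open interval, $a:I\to\mathbb{R}^+$ a smooth function, and let $\bar P=\varepsilon I\times_a\mathbb{M}^N_\lambda(c)$ be the product $I\times\mathbb{M}^N_\lambda(c)$ with the warped product metric $\langle\,,\rangle=\varepsilon\,dt^2+a(t)^2g$ and Levi-Civita connection $\bar\nabla$. Let $M$ be a connected semi-Riemannian manifold with Levi-Civita connection $\nabla$, isometrically immersed in $\bar P$ by a smooth map $f$; tangent vectors of $M$ are identified with their images under $df$. Let $\alpha$ be the second fundamental form (the normal part of $\bar\nabla_XY$ for $X,Y$ tangent to $M$), let $A_\eta$ be the shape operator in the normal direction $\eta$, $\langle A_\eta X,Y\rangle=\langle\alpha(X,Y),\eta\rangle$, and let $\nabla^\perp$ be the normal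 connection (the normal part of $\bar\nabla_X\eta$ for normal fields $\eta$). Let $\pi:M\to I$ be the composition of $f$ with the projection $\bar P\to I$, let $T=\varepsilon\,\mathrm{grad}(\pi)$, and define $\xi$ along $f$ by $\partial_t=T+\xi$. Then $\xi$ is normal to $M$ and, for every $x\in M$ and every $X\in T_xM$, with $a$ and $a'$ evaluated at $\pi(x)$: 1. $\bar\nabla_X\partial_t=\frac{a'}{a}\bigl(X-\varepsilon\langle X,T\rangle\partial_t\bigr)$; 2. $\nabla_XT=\frac{a'}{a}\bigl(X-\varepsilon\langle X,T\rangle T\bigr)+A_\xi X$; 3. $\nabla^\perp_X\xi=-\frac{\varepsilon a'}{a}\langle X,T\rangle\,\xi-\alpha(X,T)$. -/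

import Mathlib

open Bundle Manifold FiberBundle
open scoped ContDiff Topology

noncomputable section

section General

variable {E : Type*} [NormedAddCommGroup E] [NormedSpace ℝ E]
  {H : Type*} [TopologicalSpace H] {I : ModelWithCorners ℝ E H}
  {M : Type*} [TopologicalSpace M] [ChartedSpace H M]
  {F : Type*} [NormedAddCommGroup F] [NormedSpace ℝ F]
  {G : Type*} [TopologicalSpace G] {J : ModelWithCorners ℝ F G}
  {P : Type*} [TopologicalSpace P] [ChartedSpace G P]

/-- A smooth semi-Riemannian metric on `M`: a smooth symmetric nondegenerate (0,2)-tensor field,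
of arbitrary signature. Its index is locally constant, hence constant if `M` is connected. -/
structure SemiRiemannianMetric (I : ModelWithCorners ℝ E H)
    (M : Type*) [TopologicalSpace M] [ChartedSpace H M] [IsManifold I ∞ M] where
  val (x : M) : TangentSpace I x →L[ℝ] TangentSpace I x →L[ℝ] ℝ
  symm (x : M) (v w : TangentSpace I x) : val x v w = val x w v
  nondegenerate (x : M) (v : TangentSpace I x) : (∀ w, val x v w = 0) → v = 0
  contMDiff : ContMDiff I (I.prod 𝓘(ℝ, E →L[ℝ] E →L[ℝ] ℝ)) ∞
    (fun x ↦ TotalSpace.mk' (E →L[ℝ] E →L[ℝ] ℝ) x (val x))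

/-- `∇` is a Levi-Civita connection of `g`: torsion free and compatible with `g`.
In Mathlib, `nabla Y x (X x)` is `(∇_X Y)(x)`. -/
structure IsLeviCivita [IsManifold I ∞ M] (g : SemiRiemannianMetric I M)
    (nabla : CovariantDerivative I E (TangentSpace I : M → Type _)) : Prop where
  torsion_free : ∀ (X Y : Π x : M, TangentSpace I x) (x : M),
    MDiffAt (T% X) x → MDiffAt (T% Y) x →
    nabla Y x (X x) - nabla X x (Y x) = VectorField.mlieBracket I X Y x
  compatible : ∀ (Y Z : Π x : M, TangentSpace I x) (x : M) (v : TangentSpace I x),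
    MDiffAt (T% Y) x → MDiffAt (T% Z) x →
    mvfderiv I (fun y ↦ g.val y (Y y) (Z y)) x v
      = g.val x (nabla Y x v) (Z x) + g.val x (Y x) (nabla Z x v)

section Sharp
variable [IsManifold I ∞ M]
namespace SemiRiemannianMetric

theorem eq_of_val_eq (g : SemiRiemannianMetric I M) {x : M} {v v' : TangentSpace I x}
    (h : ∀ w, g.val x v w = g.val x v' w) : v = v' := by
  rw [← sub_eq_zero]
  exact g.nondegenerate x _ fun w ↦ by simp [h w]

variable [FiniteDimensional ℝ E]

theorem exists_unique_dual (g : SemiRiemannianMetric I M) (x : M) (φ : TangentSpace I x →ₗ[ℝ] ℝ) :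
    ∃! v, ∀ w, g.val x v w = φ w := by
  have : FiniteDimensional ℝ (TangentSpace I x) := inferInstanceAs (FiniteDimensional ℝ E)
  let B : TangentSpace I x →ₗ[ℝ] Module.Dual ℝ (TangentSpace I x) :=
    { toFun := fun v ↦ (g.val x v).toLinearMap
      map_add' := by intro v w; ext; simp
      map_smul' := by intro v w; ext; simp }
  have hB : Function.Injective B := by
    rw [← LinearMap.ker_eq_bot, LinearMap.ker_eq_bot']
    intro v hv
    exact g.nondegenerate x v fun w ↦ LinearMap.congr_fun hv w
  have hB2 : Function.Surjective B :=
    (LinearMap.injective_iff_surjective_of_finrank_eq_finrank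
      (Subspace.dual_finrank_eq).symm).1 hB
  obtain ⟨v, hv⟩ := hB2 φ
  refine ⟨v, fun w ↦ by rw [← hv]; rfl, fun v' hv' ↦ hB ?_⟩
  rw [hv]; ext w; exact hv' w

/-- The vector metrically equivalent to a covector: `⟨sharp φ, w⟩ = φ w` for all `w`. -/
def sharp (g : SemiRiemannianMetric I M) (x : M) (φ : TangentSpace I x →ₗ[ℝ] ℝ) :
    TangentSpace I x := (g.exists_unique_dual x φ).choose

theorem val_sharp (g : SemiRiemannianMetric I M) (x : M) (φ : TangentSpace I x →ₗ[ℝ] ℝ)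
    (w : TangentSpace I x) : g.val x (g.sharp x φ) w = φ w :=
  (g.exists_unique_dual x φ).choose_spec.1 w

/-- The gradient of a function: `⟨grad h, w⟩ = dh(w)`. -/
def grad (g : SemiRiemannianMetric I M) (h : M → ℝ) (x : M) : TangentSpace I x :=
  g.sharp x (mvfderiv I h x).toLinearMap

end SemiRiemannianMetric
end Sharp

section Along

theorem mvfderiv_congr {h h' : M → F} {x : M} (hh : h =ᶠ[𝓝 x] h') :
    mvfderiv I h x = mvfderiv I h' x := by
  ext v
  change (mfderiv I 𝓘(ℝ, F) h x v : F) = (mfderiv I 𝓘(ℝ, F) h' x v : F)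
  rw [hh.mfderiv_eq]
  rfl


section
variable [IsManifold J 1 P]

/-- The local extension of a tangent vector `v ∈ T_x P` to a vector field which is constant in the
trivialization of `TP` around `x`. -/
def localExtension {x : P} (v : TangentSpace J x) (y : P) : TangentSpace J y :=
  (trivializationAt F (TangentSpace J) x).symmL ℝ y
    ((trivializationAt F (TangentSpace J) x).continuousLinearMapAt ℝ x v)

theorem localExtension_add {x : P} (v w : TangentSpace J x) :
    localExtension (v + w) = localExtension v + localExtension w := by
  funext y; simp [localExtension]

theorem localExtension_smul {x : P} (c : ℝ) (v : TangentSpace J x) :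
    localExtension (c • v) = c • localExtension v := by
  funext y; simp [localExtension]

theorem localExtension_self {x : P} (v : TangentSpace J x) : localExtension v x = v :=
  (trivializationAt F (TangentSpace J) x).symmL_continuousLinearMapAt
    (FiberBundle.mem_baseSet_trivializationAt' x) v

theorem localExtension_reading {x : P} (v : TangentSpace J x) {y : P}
    (hy : y ∈ (trivializationAt F (TangentSpace J) x).baseSet) :
    (trivializationAt F (TangentSpace J) x (TotalSpace.mk' F y (localExtension v y))).2
      = (trivializationAt F (TangentSpace J) x).continuousLinearMapAt ℝ x v := by
  have h := (trivializationAt F (TangentSpace J) x).continuousLinearMapAt_symmL (R := ℝ) hy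
    ((trivializationAt F (TangentSpace J) x).continuousLinearMapAt ℝ x v)
  rw [Trivialization.continuousLinearMapAt_apply, Trivialization.linearMapAt_apply,
    if_pos hy] at h
  exact h

theorem mdiffAt_localExtension {x : P} (v : TangentSpace J x) :
    MDiffAt (T% (localExtension v)) x := by
  refine (mdifferentiableAt_section ..).2 ?_
  have h : (fun y ↦ (trivializationAt F (TangentSpace J) x
      (TotalSpace.mk' F y (localExtension v y))).2) =ᶠ[𝓝 x] fun _ ↦
        (trivializationAt F (TangentSpace J) x).continuousLinearMapAt ℝ x v :=
    Filter.eventually_of_mem ((trivializationAt F (TangentSpace J) x).open_baseSet.mem_nhds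
      (FiberBundle.mem_baseSet_trivializationAt' x)) fun y hy ↦ localExtension_reading v hy
  exact mdifferentiableAt_const.congr_of_eventuallyEq h

end

variable [IsManifold J ∞ P]

/-- The covariant derivative of a vector field `σ` along `f : M → P`
(the connection induced on `f^* TP`): in the local trivialization of `TP` around `f x`, with local
frame `(e_i)` and `σ = ∑ σ^i (e_i ∘ f)`, it is
`∇_X σ = ∑ dσ^i(X) e_i + ∑ σ^i ∇_{df X} e_i` at `x`. -/
def covAlong (nabla : CovariantDerivative J F (TangentSpace J : P → Type _)) (f : M → P)
    (σ : Π x : M, TangentSpace J (f x)) (x : M) : TangentSpace I x →L[ℝ] TangentSpace J (f x) :=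
  ((trivializationAt F (TangentSpace J) (f x)).symmL ℝ (f x)) ∘L
      mvfderiv I (fun y ↦ (trivializationAt F (TangentSpace J) (f x)
        (TotalSpace.mk' F (f y) (σ y))).2) x
    + (nabla (localExtension (σ x)) (f x)) ∘L mfderiv I J f x


theorem mdiffAt_reading {f : M → P} {σ : Π x : M, TangentSpace J (f x)} {x : M}
    (h : MDifferentiableAt I J.tangent (fun y ↦ TotalSpace.mk' F (f y) (σ y)) x) :
    MDifferentiableAt I 𝓘(ℝ, F) (fun y ↦ (trivializationAt F (TangentSpace J) (f x)
        (TotalSpace.mk' F (f y) (σ y))).2) x :=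
  ((mdifferentiableAt_totalSpace _ _).1 h).2

theorem covAlong_add (nabla : CovariantDerivative J F (TangentSpace J : P → Type _)) {f : M → P}
    {σ τ : Π x : M, TangentSpace J (f x)} {x : M}
    (hσ : MDifferentiableAt I J.tangent (fun y ↦ TotalSpace.mk' F (f y) (σ y)) x)
    (hτ : MDifferentiableAt I J.tangent (fun y ↦ TotalSpace.mk' F (f y) (τ y)) x) :
    covAlong (I := I) nabla f (σ + τ) x = covAlong nabla f σ x + covAlong nabla f τ x := by
  have hf : ContinuousAt f x := ((mdifferentiableAt_totalSpace _ _).1 hσ).1.continuousAt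
  have h : (fun y ↦ (trivializationAt F (TangentSpace J) (f x)
        (TotalSpace.mk' F (f y) ((σ + τ) y))).2) =ᶠ[𝓝 x]
      (fun y ↦ (trivializationAt F (TangentSpace J) (f x) (TotalSpace.mk' F (f y) (σ y))).2) +
      (fun y ↦ (trivializationAt F (TangentSpace J) (f x) (TotalSpace.mk' F (f y) (τ y))).2) := by
    filter_upwards [hf.preimage_mem_nhds
      ((trivializationAt F (TangentSpace J) (f x)).open_baseSet.mem_nhds
        (FiberBundle.mem_baseSet_trivializationAt' (f x)))] with y hy
    exact ((trivializationAt F (TangentSpace J) (f x)).linear ℝ hy).map_add (σ y) (τ y)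
  simp only [covAlong]
  rw [mvfderiv_congr h, mvfderiv_add (mdiffAt_reading hσ) (mdiffAt_reading hτ),
    Pi.add_apply, localExtension_add,
    nabla.isCovariantDerivativeOn.add (mdiffAt_localExtension _) (mdiffAt_localExtension _)]
  ext X
  simp
  abel

theorem covAlong_const_smul (nabla : CovariantDerivative J F (TangentSpace J : P → Type _))
    {f : M → P} {σ : Π x : M, TangentSpace J (f x)} {x : M} (c : ℝ)
    (hσ : MDifferentiableAt I J.tangent (fun y ↦ TotalSpace.mk' F (f y) (σ y)) x) :
    covAlong (I := I) nabla f (c • σ) x = c • covAlong nabla f σ x := by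
  have hf : ContinuousAt f x := ((mdifferentiableAt_totalSpace _ _).1 hσ).1.continuousAt
  have h : (fun y ↦ (trivializationAt F (TangentSpace J) (f x)
        (TotalSpace.mk' F (f y) ((c • σ) y))).2) =ᶠ[𝓝 x]
      (fun _ : M ↦ c) • (fun y ↦ (trivializationAt F (TangentSpace J) (f x)
        (TotalSpace.mk' F (f y) (σ y))).2) := by
    filter_upwards [hf.preimage_mem_nhds
      ((trivializationAt F (TangentSpace J) (f x)).open_baseSet.mem_nhds
        (FiberBundle.mem_baseSet_trivializationAt' (f x)))] with y hy
    exact ((trivializationAt F (TangentSpace J) (f x)).linear ℝ hy).map_smul c (σ y)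
  simp only [covAlong]
  rw [mvfderiv_congr h, mvfderiv_smul (a := fun _ : M ↦ c) mdifferentiableAt_const (mdiffAt_reading hσ),
    mvfderiv_const,
    Pi.smul_apply, localExtension_smul,
    nabla.isCovariantDerivativeOn.smul_const _ (mdiffAt_localExtension _)]
  ext X
  simp

/-- For the restriction to `f` of a vector field on `P`, the derivative along `f` is the ambient
one. -/
theorem covAlong_comp [FiniteDimensional ℝ F]
    (nabla : CovariantDerivative J F (TangentSpace J : P → Type _)) {f : M → P}
    {Y : Π p : P, TangentSpace J p} {x : M} (hf : MDifferentiableAt I J f x)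
    (hY : MDiffAt (T% Y) (f x)) :
    covAlong (I := I) nabla f (fun y ↦ Y (f y)) x = (nabla Y (f x)) ∘L mfderiv I J f x := by
  let t := trivializationAt F (TangentSpace J) (f x)
  have hmem := t.open_baseSet.mem_nhds (FiberBundle.mem_baseSet_trivializationAt' (f x))
  let Φ : (Π p : P, TangentSpace J p) → (TangentSpace J (f x) →L[ℝ] TangentSpace J (f x)) :=
    fun Z ↦ nabla Z (f x) - (t.symmL ℝ (f x)) ∘L mvfderiv J (fun p ↦ (t (TotalSpace.mk' F p (Z p))).2) (f x)
  have hread {Z : Π p : P, TangentSpace J p} (hZ : MDiffAt (T% Z) (f x)) :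
      MDifferentiableAt J 𝓘(ℝ, F) (fun p ↦ (t (TotalSpace.mk' F p (Z p))).2) (f x) :=
    (mdifferentiableAt_section ..).1 hZ
  have hΦ : TensorialAt J F Φ (f x) := by
    refine ⟨fun {h Z} hh hZ ↦ ?_, fun {Z Z'} hZ hZ' ↦ ?_⟩
    · have e : (fun p ↦ (t (TotalSpace.mk' F p ((h • Z) p))).2) =ᶠ[𝓝 (f x)]
          h • (fun p ↦ (t (TotalSpace.mk' F p (Z p))).2) := by
        filter_upwards [hmem] with y hy
        exact (t.linear ℝ hy).map_smul (h y) (Z y)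
      simp only [Φ]
      rw [nabla.isCovariantDerivativeOn.leibniz hZ hh, mvfderiv_congr e,
        mvfderiv_smul hh (hread hZ)]
      have hs : t.symmL ℝ (f x) (t (TotalSpace.mk' F (f x) (Z (f x)))).2 = Z (f x) := by
        have hb := FiberBundle.mem_baseSet_trivializationAt' (F := F) (E := TangentSpace J) (f x)
        have h1 := t.symmL_continuousLinearMapAt (R := ℝ) hb (Z (f x))
        rwa [Trivialization.continuousLinearMapAt_apply, Trivialization.linearMapAt_apply,
          if_pos hb] at h1
      ext v
      simp [hs, smul_sub]
    · have e : (fun p ↦ (t (TotalSpace.mk' F p ((Z + Z') p))).2) =ᶠ[𝓝 (f x)]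
          (fun p ↦ (t (TotalSpace.mk' F p (Z p))).2) +
          (fun p ↦ (t (TotalSpace.mk' F p (Z' p))).2) := by
        filter_upwards [hmem] with y hy
        exact (t.linear ℝ hy).map_add (Z y) (Z' y)
      simp only [Φ]
      rw [nabla.isCovariantDerivativeOn.add hZ hZ', mvfderiv_congr e,
        mvfderiv_add (hread hZ) (hread hZ')]
      ext v
      simp
      abel
  have key := hΦ.pointwise hY (mdiffAt_localExtension (Y (f x))) (localExtension_self _).symm
  have e : (fun p ↦ (t (TotalSpace.mk' F p (localExtension (Y (f x)) p))).2) =ᶠ[𝓝 (f x)]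
      fun _ ↦ t.continuousLinearMapAt ℝ (f x) (Y (f x)) := by
    filter_upwards [hmem] with y hy
    exact localExtension_reading _ hy
  simp only [Φ] at key
  rw [mvfderiv_congr e, mvfderiv_const, ContinuousLinearMap.comp_zero, sub_zero] at key
  simp only [covAlong]
  rw [← key]
  have hc : mvfderiv I (fun y ↦ (t (TotalSpace.mk' F (f y) (Y (f y)))).2) x
      = (mvfderiv J (fun p ↦ (t (TotalSpace.mk' F p (Y p))).2) (f x)) ∘L mfderiv I J f x := by
    have h := mfderiv_comp x (hread hY) hf
    ext v
    exact congr($h v)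
  rw [hc, ContinuousLinearMap.sub_comp, ContinuousLinearMap.comp_assoc]
  abel

end Along

section Pullback

/-- The pullback `(v, w) ↦ B (D v) (D w)` of a bilinear form. -/
def pullbackForm {V W : Type*} [AddCommGroup V] [Module ℝ V] [TopologicalSpace V]
    [AddCommGroup W] [Module ℝ W] [TopologicalSpace W] (B : W →L[ℝ] W →L[ℝ] ℝ) (D : V →L[ℝ] W) : V →L[ℝ] V →L[ℝ] ℝ :=
  (D.precomp ℝ) ∘L B ∘L D

theorem pullbackForm_apply {V W : Type*} [AddCommGroup V] [Module ℝ V] [TopologicalSpace V]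
    [AddCommGroup W] [Module ℝ W] [TopologicalSpace W] (B : W →L[ℝ] W →L[ℝ] ℝ) (D : V →L[ℝ] W)
    (v w : V) : pullbackForm B D v w = B (D v) (D w) := rfl

variable [IsManifold I ∞ M] [IsManifold J ∞ P]

theorem linearMapAt_dual_apply {x y : P}
    (hy : y ∈ (trivializationAt F (TangentSpace J) x).baseSet) (φ : TangentSpace J y →L[ℝ] ℝ)
    (w : F) :
    (Trivialization.linearMapAt ℝ
      (trivializationAt (F →L[ℝ] ℝ) (fun p : P ↦ TangentSpace J p →L[ℝ] ℝ) x) y φ) w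
      = φ ((trivializationAt F (TangentSpace J) x).symmL ℝ y w) := by
  rw [Trivialization.linearMapAt_apply, if_pos ⟨hy, Set.mem_univ _⟩]
  simp [hom_trivializationAt_apply, ContinuousLinearMap.inCoordinates]

theorem contMDiff_pullback {g : Π p : P, TangentSpace J p →L[ℝ] TangentSpace J p →L[ℝ] ℝ}
    (hg : ContMDiff J (J.prod 𝓘(ℝ, F →L[ℝ] F →L[ℝ] ℝ)) ∞
      (fun x ↦ TotalSpace.mk' (F →L[ℝ] F →L[ℝ] ℝ) x (g x)))
    {f : M → P} (hf : ContMDiff I J ∞ f) :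
    ContMDiff I (I.prod 𝓘(ℝ, E →L[ℝ] E →L[ℝ] ℝ)) ∞
      (fun x ↦ TotalSpace.mk' (E →L[ℝ] E →L[ℝ] ℝ)
        (E := fun x : M ↦ TangentSpace I x →L[ℝ] TangentSpace I x →L[ℝ] ℝ) x
        (pullbackForm (g (f x)) (mfderiv I J f x))) := by
  intro x₀
  rw [contMDiffAt_section]
  have h1 := ((contMDiffAt_section _).1 (hg (f x₀))).comp x₀ hf.contMDiffAt
  have h2 := (hf x₀).mfderiv_const (m := ∞) (by simp)
  have h3 := (h2.clm_precomp (F₃ := ℝ)).clm_comp (h1.clm_comp h2)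
  refine h3.congr_of_eventuallyEq ?_
  filter_upwards [hf.continuous.continuousAt.preimage_mem_nhds
      ((trivializationAt F (TangentSpace J) (f x₀)).open_baseSet.mem_nhds
        (FiberBundle.mem_baseSet_trivializationAt' (f x₀))),
    (trivializationAt E (TangentSpace I) x₀).open_baseSet.mem_nhds
      (FiberBundle.mem_baseSet_trivializationAt' x₀)] with y hy hx
  ext v w
  simp [hom_trivializationAt_apply, ContinuousLinearMap.inCoordinates, pullbackForm, inTangentCoordinates]
  rw [linearMapAt_dual_apply hx, linearMapAt_dual_apply hy]
  have h4 (u : TangentSpace J (f y)) :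
      (trivializationAt F (TangentSpace J) (f x₀)).symmL ℝ (f y)
        ((trivializationAt F (TangentSpace J) (f x₀)).linearMapAt ℝ (f y) u) = u := by
    have := (trivializationAt F (TangentSpace J) (f x₀)).symmL_continuousLinearMapAt (R := ℝ) hy u
    simpa using this
  simp [h4]
end Pullback

section Submanifold
variable [IsManifold I ∞ M] [IsManifold J ∞ P]

/-- An isometric immersion `(M, g) → (P, gP)`. -/
structure IsometricImmersion (g : SemiRiemannianMetric I M) (gP : SemiRiemannianMetric J P) where
  toFun : M → P
  contMDiff : ContMDiff I J ∞ toFun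
  injective (x : M) : Function.Injective (mfderiv I J toFun x)
  isometric (x : M) (v w : TangentSpace I x) :
    gP.val (toFun x) (mfderiv I J toFun x v) (mfderiv I J toFun x w) = g.val x v w

namespace IsometricImmersion
variable {g : SemiRiemannianMetric I M} {gP : SemiRiemannianMetric J P}

/-- The vector field along `f` obtained by pushing forward a vector field of `M`. -/
def push (f : IsometricImmersion g gP) (Y : Π x : M, TangentSpace I x) (x : M) :
    TangentSpace J (f.toFun x) := mfderiv I J f.toFun x (Y x)

theorem mdiffAt_push (f : IsometricImmersion g gP) {Y : Π x : M, TangentSpace I x} {x : M}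
    (hY : MDiffAt (T% Y) x) :
    MDifferentiableAt I J.tangent (fun y ↦ TotalSpace.mk' F (f.toFun y) (f.push Y y)) x := by
  have h := (f.contMDiff.contMDiff_tangentMap (m := 1) (by norm_cast)).mdifferentiable one_ne_zero
  exact (h (TotalSpace.mk' E x (Y x))).comp x hY

/-- `w ∈ T_{f x} P` is normal to the immersion. -/
def IsNormal (f : IsometricImmersion g gP) (x : M) (w : TangentSpace J (f.toFun x)) : Prop :=
  ∀ v : TangentSpace I x, gP.val (f.toFun x) w (mfderiv I J f.toFun x v) = 0

variable [FiniteDimensional ℝ E]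

/-- The tangential part of `w ∈ T_{f x} P`, as a vector of `T_x M`:
`⟨tangential w, v⟩ = ⟨w, df v⟩` for all `v ∈ T_x M`. -/
def tangential (f : IsometricImmersion g gP) (x : M) :
    TangentSpace J (f.toFun x) →ₗ[ℝ] TangentSpace I x where
  toFun w := g.sharp x ((gP.val (f.toFun x) w) ∘L mfderiv I J f.toFun x).toLinearMap
  map_add' w w' := g.eq_of_val_eq fun v ↦ by simp [g.val_sharp]
  map_smul' c w := g.eq_of_val_eq fun v ↦ by simp [g.val_sharp]

/-- The normal part of `w ∈ T_{f x} P`, that is, its component in `(df T_x M)^⊥`. -/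
def normal (f : IsometricImmersion g gP) (x : M) :
    TangentSpace J (f.toFun x) →ₗ[ℝ] TangentSpace J (f.toFun x) :=
  LinearMap.id - (mfderiv I J f.toFun x).toLinearMap ∘ₗ f.tangential x

theorem normal_orthogonal (f : IsometricImmersion g gP) (x : M) (w : TangentSpace J (f.toFun x)) :
    f.IsNormal x (f.normal x w) := by
  intro v
  simp [normal, tangential, f.isometric, g.val_sharp]

/-- The second fundamental form `α(X, Y) = (∇̄_X Y)^⊥`, where `Y` is extended to a vector field
near `x`. -/
def secondFundamentalForm (f : IsometricImmersion g gP)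
    (nablaP : CovariantDerivative J F (TangentSpace J : P → Type _)) (x : M) :
    TangentSpace I x →ₗ[ℝ] TangentSpace I x →ₗ[ℝ] TangentSpace J (f.toFun x) :=
  LinearMap.mk₂ ℝ
    (fun X Y ↦ f.normal x (covAlong nablaP f.toFun (f.push (localExtension Y)) x X))
    (fun X X' Y ↦ by simp) (fun c X Y ↦ by simp)
    (fun X Y Y' ↦ by
      have h : f.push (localExtension (Y + Y')) = f.push (localExtension Y) + f.push (localExtension Y') := by
        funext y; simp [push, localExtension_add]
      rw [h, covAlong_add nablaP
        (f.mdiffAt_push (mdiffAt_localExtension _))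
        (f.mdiffAt_push (mdiffAt_localExtension _))]
      simp)
    (fun c X Y ↦ by
      have h : f.push (localExtension (c • Y)) = c • f.push (localExtension Y) := by
        funext y; simp [push, localExtension_smul]
      rw [h, covAlong_const_smul nablaP c
        (f.mdiffAt_push (mdiffAt_localExtension _))]
      simp)

/-- The shape operator: `⟨A_η X, Y⟩ = ⟨α(X, Y), η⟩` for all `Y ∈ T_x M`. -/
def shapeOperator (f : IsometricImmersion g gP)
    (nablaP : CovariantDerivative J F (TangentSpace J : P → Type _)) (x : M)
    (η : TangentSpace J (f.toFun x)) (X : TangentSpace I x) : TangentSpace I x :=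
  g.sharp x ((gP.val (f.toFun x) η).toLinearMap ∘ₗ f.secondFundamentalForm nablaP x X)

/-- The normal connection `∇^⊥_X η = (∇̄_X η)^⊥`, for a section `η` of the normal bundle. -/
def normalConnection (f : IsometricImmersion g gP)
    (nablaP : CovariantDerivative J F (TangentSpace J : P → Type _))
    (η : Π x : M, TangentSpace J (f.toFun x)) (x : M) (X : TangentSpace I x) :
    TangentSpace J (f.toFun x) :=
  f.normal x (covAlong nablaP f.toFun η x X)

end IsometricImmersion
end Submanifold
end General
/-- The standard scalar product of index `ν` on `ℝ^m`: the last `ν` coordinates count negatively. -/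
def pseudoEuclidean (m ν : ℕ) :
    EuclideanSpace ℝ (Fin m) →L[ℝ] EuclideanSpace ℝ (Fin m) →L[ℝ] ℝ :=
  LinearMap.toContinuousBilinearMap (LinearMap.mk₂ ℝ
    (fun x y ↦ ∑ i : Fin m, (if i.val + ν < m then (1 : ℝ) else -1) * (x i * y i))
    (fun x x' y ↦ by simp [add_mul, mul_add, Finset.sum_add_distrib])
    (fun r x y ↦ by simp only [PiLp.smul_apply, smul_eq_mul, Finset.mul_sum]; congr! 1; ring)
    (fun x y y' ↦ by simp [mul_add, Finset.sum_add_distrib])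
    (fun r x y ↦ by simp only [PiLp.smul_apply, smul_eq_mul, Finset.mul_sum]; congr! 1; ring))

theorem pseudoEuclidean_apply (m ν : ℕ) (x y : EuclideanSpace ℝ (Fin m)) :
    pseudoEuclidean m ν x y
      = ∑ i : Fin m, (if i.val + ν < m then (1 : ℝ) else -1) * (x i * y i) := rfl

theorem pseudoEuclidean_symm (m ν : ℕ) (x y : EuclideanSpace ℝ (Fin m)) :
    pseudoEuclidean m ν x y = pseudoEuclidean m ν y x := by
  simp [pseudoEuclidean_apply, mul_comm]

theorem pseudoEuclidean_nondegenerate (m ν : ℕ) (x : EuclideanSpace ℝ (Fin m))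
    (h : ∀ y, pseudoEuclidean m ν x y = 0) : x = 0 := by
  ext i
  have := h (EuclideanSpace.single i 1)
  rw [pseudoEuclidean_apply, Finset.sum_eq_single i (by intro j _ hj; simp [hj]) (by simp)] at this
  split_ifs at this <;> simpa using this

/-- The scalar product `g₀` of the flat space `𝔼^{N+1}_l` containing the space form of dimension
`N`, index `l` and curvature `c = ±1`: its index is `l` if `c = 1` and `l + 1` if `c = -1`. -/
def flatForm (N l : ℕ) (c : ℤˣ) :
    EuclideanSpace ℝ (Fin (N + 1)) →L[ℝ] EuclideanSpace ℝ (Fin (N + 1)) →L[ℝ] ℝ :=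
  pseudoEuclidean (N + 1) (if c = 1 then l else l + 1)

/-- The central quadric `{p ∈ 𝔼^{N+1}_l ; g₀(p, p) = c}`. -/
@[ext]
structure Quadric (N l : ℕ) (c : ℤˣ) where
  val : EuclideanSpace ℝ (Fin (N + 1))
  property : flatForm N l c val val = ((c : ℤ) : ℝ)

namespace Quadric
variable {N l : ℕ} {c : ℤˣ}

instance : TopologicalSpace (Quadric N l c) :=
  TopologicalSpace.induced Quadric.val inferInstance

theorem isInducing_val : Topology.IsInducing (Quadric.val : Quadric N l c → _) := ⟨rfl⟩

theorem continuous_val : Continuous (Quadric.val : Quadric N l c → _) := isInducing_val.continuous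

theorem coe_mul_self (c : ℤˣ) : ((c : ℤ) : ℝ) * ((c : ℤ) : ℝ) = 1 := by
  rcases Int.units_eq_one_or c with rfl | rfl <;> simp

theorem form_symm (x y : EuclideanSpace ℝ (Fin (N + 1))) :
    flatForm N l c x y = flatForm N l c y x := pseudoEuclidean_symm _ _ x y

/-- The linear hyperplane `p^⊥` of `𝔼^{N+1}_l`. -/
def orth (p : Quadric N l c) : Submodule ℝ (EuclideanSpace ℝ (Fin (N + 1))) :=
  LinearMap.ker (flatForm N l c p.val).toLinearMap

theorem mem_orth {p : Quadric N l c} {w : EuclideanSpace ℝ (Fin (N + 1))} :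
    w ∈ orth p ↔ flatForm N l c p.val w = 0 := Iff.rfl

theorem finrank_orth (p : Quadric N l c) : Module.finrank ℝ (orth p) = N := by
  have h : (flatForm N l c p.val).toLinearMap ≠ 0 := by
    intro h
    have h1 : flatForm N l c p.val p.val = 0 := LinearMap.congr_fun h p.val
    rw [p.property] at h1
    have := coe_mul_self c
    rw [h1] at this
    simp at this
  have := Module.Dual.finrank_ker_add_one_of_ne_zero (f := (flatForm N l c p.val).toLinearMap) h
  rw [finrank_euclideanSpace_fin] at this
  exact Nat.add_right_cancel this

/-- Linear coordinates on `p^⊥`. -/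
def orthEquiv (p : Quadric N l c) : orth p ≃L[ℝ] EuclideanSpace ℝ (Fin N) :=
  ContinuousLinearEquiv.ofFinrankEq (by rw [finrank_orth, finrank_euclideanSpace_fin])

/-- The `g₀`-orthogonal projection onto `p^⊥`. -/
def orthProj (p : Quadric N l c) : EuclideanSpace ℝ (Fin (N + 1)) →L[ℝ] orth p :=
  (ContinuousLinearMap.id ℝ _ - (((c : ℤ) : ℝ) • flatForm N l c p.val).smulRight p.val).codRestrict
    (orth p) (fun x ↦ by
      rw [mem_orth]
      simp only [_root_.sub_apply, ContinuousLinearMap.id_apply,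
        ContinuousLinearMap.smulRight_apply, _root_.smul_apply, map_sub, map_smul,
        smul_eq_mul, p.property]
      linear_combination (-(flatForm N l c p.val x)) * coe_mul_self c)

theorem coe_orthProj (p : Quadric N l c) (x : EuclideanSpace ℝ (Fin (N + 1))) :
    (orthProj p x : EuclideanSpace ℝ (Fin (N + 1)))
      = x - (((c : ℤ) : ℝ) * flatForm N l c p.val x) • p.val := rfl

/-- `1 - c g₀(w, w)` for `w ∈ p^⊥` with linear coordinates `v`. -/
def height (p : Quadric N l c) (v : EuclideanSpace ℝ (Fin N)) : ℝ :=
  1 - ((c : ℤ) : ℝ) * flatForm N l c ((orthEquiv p).symm v : EuclideanSpace ℝ (Fin (N + 1)))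
    ((orthEquiv p).symm v : EuclideanSpace ℝ (Fin (N + 1)))

/-- The graph parametrization `w ↦ √(1 - c g₀(w, w)) p + w` of the quadric over `p^⊥`. -/
def param (p : Quadric N l c) (v : EuclideanSpace ℝ (Fin N)) : EuclideanSpace ℝ (Fin (N + 1)) :=
  √(height p v) • p.val + ((orthEquiv p).symm v : EuclideanSpace ℝ (Fin (N + 1)))

theorem form_param (p : Quadric N l c) (v : EuclideanSpace ℝ (Fin N)) :
    flatForm N l c p.val (param p v) = √(height p v) * ((c : ℤ) : ℝ) := by
  have h : flatForm N l c p.val ((orthEquiv p).symm v : EuclideanSpace ℝ (Fin (N + 1))) = 0 :=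
    ((orthEquiv p).symm v).2
  simp [param, h, p.property]

theorem param_mem (p : Quadric N l c) {v : EuclideanSpace ℝ (Fin N)} (hv : 0 ≤ height p v) :
    flatForm N l c (param p v) (param p v) = ((c : ℤ) : ℝ) := by
  have h : flatForm N l c p.val ((orthEquiv p).symm v : EuclideanSpace ℝ (Fin (N + 1))) = 0 :=
    ((orthEquiv p).symm v).2
  have h1 : flatForm N l c (param p v) (param p v) = √(height p v) * √(height p v) * ((c : ℤ) : ℝ)
      + flatForm N l c ((orthEquiv p).symm v : EuclideanSpace ℝ (Fin (N + 1)))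
        ((orthEquiv p).symm v : EuclideanSpace ℝ (Fin (N + 1))) := by
    simp only [param, map_add, map_smul, _root_.add_apply,
      _root_.smul_apply, smul_eq_mul, h, p.property,
      form_symm ((orthEquiv p).symm v : EuclideanSpace ℝ (Fin (N + 1))) p.val]
    ring
  rw [h1, Real.mul_self_sqrt hv, height]
  linear_combination (-flatForm N l c ((orthEquiv p).symm v : EuclideanSpace ℝ (Fin (N + 1)))
        ((orthEquiv p).symm v : EuclideanSpace ℝ (Fin (N + 1)))) * coe_mul_self c

theorem orthProj_param (p : Quadric N l c) (v : EuclideanSpace ℝ (Fin N)) :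
    orthProj p (param p v) = (orthEquiv p).symm v := by
  ext1
  rw [coe_orthProj, form_param, param]
  have : ((c : ℤ) : ℝ) * (√(height p v) * ((c : ℤ) : ℝ)) = √(height p v) := by
    linear_combination √(height p v) * coe_mul_self c
  rw [this]; abel

theorem height_orthProj (p q : Quadric N l c) :
    height p (orthEquiv p (orthProj p q.val)) = (((c : ℤ) : ℝ) * flatForm N l c p.val q.val) ^ 2 := by
  simp only [height, ContinuousLinearEquiv.symm_apply_apply, coe_orthProj, map_sub, map_smul,
    _root_.sub_apply, _root_.smul_apply, smul_eq_mul, p.property, q.property,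
    form_symm q.val p.val]
  have := coe_mul_self c
  set C := ((c : ℤ) : ℝ)
  set s := flatForm N l c p.val q.val
  linear_combination (-1 - C * C * s ^ 2) * this

theorem param_orthProj (p q : Quadric N l c) (h : 0 < ((c : ℤ) : ℝ) * flatForm N l c p.val q.val) :
    param p (orthEquiv p (orthProj p q.val)) = q.val := by
  rw [param, height_orthProj, Real.sqrt_sq h.le, ContinuousLinearEquiv.symm_apply_apply,
    coe_orthProj]
  abel

theorem continuous_height (p : Quadric N l c) : Continuous (height p) := by
  unfold height; fun_prop

theorem continuous_param (p : Quadric N l c) : Continuous (param p) := by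
  have := continuous_height p
  unfold param; fun_prop

open Classical in
/-- The graph parametrization as a map into the quadric, with a junk value outside its domain. -/
def lift (p : Quadric N l c) (v : EuclideanSpace ℝ (Fin N)) : Quadric N l c :=
  if h : 0 < height p v then ⟨param p v, param_mem p h.le⟩ else p

theorem lift_val (p : Quadric N l c) {v : EuclideanSpace ℝ (Fin N)} (hv : 0 < height p v) :
    (lift p v).val = param p v := by
  rw [lift, dif_pos hv]

/-- The chart of the quadric around `p`: orthogonal projection of the open part
`{q ; c g₀(p, q) > 0}` to `p^⊥`. -/
def chart (p : Quadric N l c) :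
    OpenPartialHomeomorph (Quadric N l c) (EuclideanSpace ℝ (Fin N)) where
  toFun q := orthEquiv p (orthProj p q.val)
  invFun := lift p
  source := {q | 0 < ((c : ℤ) : ℝ) * flatForm N l c p.val q.val}
  target := {v | 0 < height p v}
  map_source' q hq := by
    simp only [Set.mem_ofPred_eq] at hq ⊢
    rw [height_orthProj]; positivity
  map_target' v hv := by
    simp only [Set.mem_ofPred_eq] at hv ⊢
    rw [lift_val p hv, form_param]
    have := Real.sqrt_pos.2 hv
    linarith [show ((c : ℤ) : ℝ) * (√(height p v) * ((c : ℤ) : ℝ)) = √(height p v) by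
      linear_combination √(height p v) * coe_mul_self c]
  left_inv' q hq := by
    have h : 0 < height p (orthEquiv p (orthProj p q.val)) := by
      rw [height_orthProj]; exact pow_pos hq 2
    exact Quadric.ext ((lift_val p h).trans (param_orthProj p q hq))
  right_inv' v hv := by
    simp only [lift_val p hv, orthProj_param, ContinuousLinearEquiv.apply_symm_apply]
  open_source := by
    have := continuous_val (N := N) (l := l) (c := c)
    exact isOpen_lt continuous_const (by fun_prop)
  open_target := isOpen_lt continuous_const (continuous_height p)
  continuousOn_toFun := by
    have := continuous_val (N := N) (l := l) (c := c)
    exact Continuous.continuousOn (by fun_prop)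
  continuousOn_invFun := by
    rw [isInducing_val.continuousOn_iff]
    exact (continuous_param p).continuousOn.congr fun v hv ↦ lift_val p hv

theorem mem_chart_source (p : Quadric N l c) : p ∈ (chart p).source := by
  show 0 < ((c : ℤ) : ℝ) * flatForm N l c p.val p.val
  rw [p.property, coe_mul_self]; exact one_pos

instance : ChartedSpace (EuclideanSpace ℝ (Fin N)) (Quadric N l c) where
  atlas := Set.range chart
  chartAt := chart
  mem_chart_source := mem_chart_source
  chart_mem_atlas p := ⟨p, rfl⟩

theorem contDiffOn_param (p : Quadric N l c) : ContDiffOn ℝ ∞ (param p) {v | 0 < height p v} := by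
  have h1 : ContDiff ℝ ∞ (fun v ↦ ((orthEquiv p).symm v : EuclideanSpace ℝ (Fin (N + 1)))) :=
    ((orth p).subtypeL ∘L (orthEquiv p).symm.toContinuousLinearMap).contDiff
  have h2 : ContDiff ℝ ∞ (height p) :=
    contDiff_const.sub (contDiff_const.mul
      (((flatForm N l c).contDiff.comp h1).clm_apply h1))
  exact ((h2.contDiffOn.sqrt fun v hv ↦ ne_of_gt hv).smul contDiffOn_const).add h1.contDiffOn

instance : IsManifold (𝓡 N) ∞ (Quadric N l c) := by
  refine isManifold_of_contDiffOn _ _ _ ?_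
  rintro _ _ ⟨p, rfl⟩ ⟨q, rfl⟩
  simp only [modelWithCornersSelf_coe, modelWithCornersSelf_coe_symm, Set.range_id,
    Set.inter_univ, Set.preimage_id, Function.id_comp, Function.comp_id]
  have h : ContDiffOn ℝ ∞ (fun v ↦ orthEquiv q (orthProj q (param p v))) {v | 0 < height p v} :=
    ((orthEquiv q).toContinuousLinearMap ∘L (orthProj q)).contDiff.comp_contDiffOn
      (contDiffOn_param p)
  refine (h.mono fun v hv ↦ ?_).congr fun v hv ↦ ?_
  · exact hv.1
  · show orthEquiv q (orthProj q (lift p v).val) = _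
    rw [lift_val p hv.1]

/-- The inclusion of the quadric into the ambient vector space is smooth. -/
theorem contMDiff_val : ContMDiff (𝓡 N) 𝓘(ℝ, EuclideanSpace ℝ (Fin (N + 1))) ∞
    (Quadric.val : Quadric N l c → EuclideanSpace ℝ (Fin (N + 1))) := by
  intro p
  rw [contMDiffAt_iff]
  refine ⟨continuous_val.continuousAt, ?_⟩
  have hp : (chart p) p ∈ {v | 0 < height p v} := (chart p).map_source (mem_chart_source p)
  have h := ((contDiffOn_param p).congr fun v hv ↦ lift_val p hv).contDiffAt
    ((isOpen_lt continuous_const (continuous_height p)).mem_nhds hp)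
  simpa using! h.contDiffWithinAt

end Quadric

section Warped

theorem hasMFDerivAt_subtype_val {E : Type*} [NormedAddCommGroup E] [NormedSpace ℝ E]
    {H : Type*} [TopologicalSpace H] {I : ModelWithCorners ℝ E H}
    {M : Type*} [TopologicalSpace M] [ChartedSpace H M] {U : TopologicalSpace.Opens M} (x : U) :
    HasMFDerivAt I I (Subtype.val : U → M) x (ContinuousLinearMap.id ℝ E) := by
  refine ⟨continuous_subtype_val.continuousAt, ?_⟩
  refine (hasFDerivWithinAt_id (𝕜 := ℝ) _ _).congr_of_eventuallyEq ?_ ?_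
  · have h := extChartAt_target_mem_nhdsWithin (I := I) x
    filter_upwards [h] with y hy
    have := (extChartAt I x).right_inv hy
    exact this
  · simp [writtenInExtChartAt]
    rfl

theorem contMDiff_constForm {V : Type*} [NormedAddCommGroup V] [NormedSpace ℝ V]
    (B : V →L[ℝ] V →L[ℝ] ℝ) :
    ContMDiff 𝓘(ℝ, V) (𝓘(ℝ, V).prod 𝓘(ℝ, V →L[ℝ] V →L[ℝ] ℝ)) ∞
      (fun x : V ↦ TotalSpace.mk' (V →L[ℝ] V →L[ℝ] ℝ)
        (E := fun x : V ↦ TangentSpace 𝓘(ℝ, V) x →L[ℝ] TangentSpace 𝓘(ℝ, V) x →L[ℝ] ℝ) x B) := by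
  intro x
  refine (contMDiffAt_section (F := V →L[ℝ] V →L[ℝ] ℝ)
    (E := fun x : V ↦ TangentSpace 𝓘(ℝ, V) x →L[ℝ] TangentSpace 𝓘(ℝ, V) x →L[ℝ] ℝ) (s := fun _ ↦ B)
    x).2 ?_
  convert! contMDiffAt_const (c := B)
  ext v w
  erw [hom_trivializationAt_apply]
  simp [ContinuousLinearMap.inCoordinates]
  erw [linearMapAt_dual_apply (Set.mem_univ _)]
  simp
  rfl

variable {F : Type*} [NormedAddCommGroup F] [NormedSpace ℝ F]
  {G : Type*} [TopologicalSpace G] {J : ModelWithCorners ℝ F G}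
  {P : Type*} [TopologicalSpace P] [ChartedSpace G P] 

/-- The projection `(t, p) ↦ t` of `S × P` to the coordinate of the open set `S ⊆ ℝ`. -/
def timeCoord (S : TopologicalSpace.Opens ℝ) (q : S × P) : ℝ := (q.1 : ℝ)

/-- The coordinate vector field `∂_t` on `S × P`. -/
def partialT (S : TopologicalSpace.Opens ℝ) (q : S × P) : TangentSpace (𝓘(ℝ, ℝ).prod J) q :=
  ((1 : ℝ), (0 : F))

theorem hasMFDerivAt_timeCoord (S : TopologicalSpace.Opens ℝ) (q : S × P) :
    HasMFDerivAt (𝓘(ℝ, ℝ).prod J) 𝓘(ℝ, ℝ) (timeCoord S : S × P → ℝ) q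
      (ContinuousLinearMap.fst ℝ ℝ F) :=
  (hasMFDerivAt_subtype_val (I := 𝓘(ℝ, ℝ)) q.1).comp q (hasMFDerivAt_fst q)

theorem mvfderiv_timeCoord (S : TopologicalSpace.Opens ℝ) (q : S × P)
    (v : TangentSpace (𝓘(ℝ, ℝ).prod J) q) :
    mvfderiv (𝓘(ℝ, ℝ).prod J) (timeCoord S : S × P → ℝ) q v = (v : ℝ × F).1 := 
  congr($((hasMFDerivAt_timeCoord (J := J) S q).mfderiv) v)

theorem contMDiff_timeCoord (S : TopologicalSpace.Opens ℝ) :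
    ContMDiff (𝓘(ℝ, ℝ).prod J) 𝓘(ℝ, ℝ) ∞ (timeCoord S : S × P → ℝ) :=
  contMDiff_subtype_val.comp contMDiff_fst

variable [IsManifold J ∞ P]

/-- The warped product metric `ε dt² + a(t)² g_P` on `S × P`, written `ε S ×_a P`, for an open
`S ⊆ ℝ` and a smooth positive `a` on `S`. -/
def warpedMetric (ε : ℤˣ) (S : TopologicalSpace.Opens ℝ) (a : ℝ → ℝ)
    (ha : ContDiffOn ℝ ∞ a S) (hpos : ∀ t ∈ S, 0 < a t) (gP : SemiRiemannianMetric J P) :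
    SemiRiemannianMetric (𝓘(ℝ, ℝ).prod J) (S × P) where
  val q := ((ε : ℤ) : ℝ) • pullbackForm (ContinuousLinearMap.mul ℝ ℝ)
      (mvfderiv (𝓘(ℝ, ℝ).prod J) (timeCoord S : S × P → ℝ) q)
    + (a (timeCoord S q)) ^ 2 • pullbackForm (gP.val q.2)
      (mfderiv (𝓘(ℝ, ℝ).prod J) J (Prod.snd : S × P → P) q)
  symm q v w := by
    simp only [_root_.add_apply, _root_.smul_apply, pullbackForm_apply, ContinuousLinearMap.mul_apply',
      mul_comm (mvfderiv (𝓘(ℝ, ℝ).prod J) (timeCoord S : S × P → ℝ) q v)]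
    rw [gP.symm]
  nondegenerate q v h := by
    simp only [_root_.add_apply, _root_.smul_apply, pullbackForm_apply, ContinuousLinearMap.mul_apply',
      mvfderiv_timeCoord, mfderiv_snd, smul_eq_mul] at h
    have hε : ((ε : ℤ) : ℝ) ≠ 0 := by
      rcases Int.units_eq_one_or ε with rfl | rfl <;> simp
    have ha0 : a (timeCoord S q) ≠ 0 := ne_of_gt (hpos _ q.1.2)
    refine Prod.ext ?_ (gP.nondegenerate q.2 _ fun w ↦ ?_)
    · have h1 := h ((1 : ℝ), (0 : F))
      have h2 : gP.val q.2 (v : ℝ × F).2 (0 : F) = 0 := map_zero _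
      change _ * ((v : ℝ × F).1 * 1) + _ * gP.val q.2 (v : ℝ × F).2 (0 : F) = 0 at h1
      rw [h2] at h1
      have h3 : (v : ℝ × F).1 = 0 := by simpa [hε] using h1
      exact h3
    · have h1 := h ((0 : ℝ), w)
      change _ * ((v : ℝ × F).1 * 0) + _ * gP.val q.2 (v : ℝ × F).2 w = 0 at h1
      simpa [ha0] using h1
  contMDiff := by
    have h1 := contMDiff_pullback (contMDiff_constForm (ContinuousLinearMap.mul ℝ ℝ))
      (contMDiff_timeCoord (P := P) (J := J) S)
    have h2 := contMDiff_pullback gP.contMDiff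
      (contMDiff_snd (I := 𝓘(ℝ, ℝ)) (J := J) (M := S) (N := P))
    have h3 : ContMDiff (𝓘(ℝ, ℝ).prod J) 𝓘(ℝ, ℝ) ∞ (fun q : S × P ↦ (a (timeCoord S q)) ^ 2) := by
      refine ContMDiff.pow (fun q ↦ ?_) 2
      exact ((ha.contDiffAt (S.isOpen.mem_nhds q.1.2)).contMDiffAt).comp q
        (contMDiff_timeCoord S q)
    exact (h1.const_smul_section (a := ((ε : ℤ) : ℝ))).add_section (h3.smul_section h2)

end Warped

section SpaceForm
variable {N l : ℕ} {c : ℤˣ}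

/-- The connected component of `p₀` in the quadric: the space form `𝕄^N_l(c)`. -/
def SpaceForm (p₀ : Quadric N l c) : TopologicalSpace.Opens (Quadric N l c) where
  carrier := connectedComponent p₀
  is_open' := by
    have : LocallyConnectedSpace (Quadric N l c) :=
      ChartedSpace.locallyConnectedSpace (EuclideanSpace ℝ (Fin N)) _
    exact isOpen_connectedComponent

/-- The inclusion `Ξ` of the space form into the flat space. -/
def SpaceForm.incl (p₀ : Quadric N l c) (q : SpaceForm p₀) : EuclideanSpace ℝ (Fin (N + 1)) :=
  q.1.val

theorem SpaceForm.contMDiff_incl (p₀ : Quadric N l c) :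
    ContMDiff (𝓡 N) 𝓘(ℝ, EuclideanSpace ℝ (Fin (N + 1))) ∞ (SpaceForm.incl p₀) :=
  Quadric.contMDiff_val.comp contMDiff_subtype_val

theorem Quadric.hasFDerivAt_param (p : Quadric N l c) :
    HasFDerivAt (Quadric.param p)
      ((Quadric.orth p).subtypeL ∘L (Quadric.orthEquiv p).symm.toContinuousLinearMap) 0 := by
  set A := (Quadric.orth p).subtypeL ∘L (Quadric.orthEquiv p).symm.toContinuousLinearMap with hA
  have h1 : HasFDerivAt (Quadric.height p)
      (0 : EuclideanSpace ℝ (Fin N) →L[ℝ] ℝ) 0 := by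
    have h := (((flatForm N l c).isBoundedBilinearMap.hasFDerivAt (A 0, A 0)).comp
      (0 : EuclideanSpace ℝ (Fin N)) (A.hasFDerivAt.prodMk A.hasFDerivAt)).const_mul ((c : ℤ) : ℝ)
      |>.const_sub 1
    refine h.congr_fderiv ?_
    ext v
    simp
  have h0 : Quadric.height p 0 = 1 := by simp [Quadric.height]
  have h2 := ((h1.sqrt (by rw [h0]; exact one_ne_zero)).smul_const p.val).add A.hasFDerivAt
  refine h2.congr_fderiv ?_
  ext v
  simp

theorem Quadric.hasMFDerivAt_val (p : Quadric N l c) :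
    HasMFDerivAt (𝓡 N) 𝓘(ℝ, EuclideanSpace ℝ (Fin (N + 1))) Quadric.val p
      ((Quadric.orth p).subtypeL ∘L (Quadric.orthEquiv p).symm.toContinuousLinearMap) := by
  refine ⟨Quadric.continuous_val.continuousAt, ?_⟩
  have h0 : (chartAt (EuclideanSpace ℝ (Fin N)) p) p = 0 := by
    change Quadric.orthEquiv p (Quadric.orthProj p p.val) = 0
    have : Quadric.orthProj p p.val = 0 := by
      ext1
      rw [Quadric.coe_orthProj, p.property, Quadric.coe_mul_self]
      simp
    rw [this, map_zero]
  have h : HasFDerivAt (Quadric.val ∘ Quadric.lift p)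
      ((Quadric.orth p).subtypeL ∘L (Quadric.orthEquiv p).symm.toContinuousLinearMap) 0 := by
    refine (Quadric.hasFDerivAt_param p).congr_of_eventuallyEq ?_
    have hm : {v | 0 < Quadric.height p v} ∈ 𝓝 (0 : EuclideanSpace ℝ (Fin N)) :=
      (isOpen_lt continuous_const (Quadric.continuous_height p)).mem_nhds
        (by simp [Quadric.height])
    filter_upwards [hm] with v hv
    exact Quadric.lift_val p hv
  have h' := h.hasFDerivWithinAt (s := Set.range (𝓡 N))
  rw [← h0] at h'
  exact h'

theorem SpaceForm.hasMFDerivAt_incl (p₀ : Quadric N l c) (q : SpaceForm p₀) :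
    HasMFDerivAt (𝓡 N) 𝓘(ℝ, EuclideanSpace ℝ (Fin (N + 1))) (SpaceForm.incl p₀) q
      ((Quadric.orth q.1).subtypeL ∘L (Quadric.orthEquiv q.1).symm.toContinuousLinearMap) :=
  (Quadric.hasMFDerivAt_val q.1).comp q (hasMFDerivAt_subtype_val q)

/-- The metric of the space form, induced by `g₀`. -/
def SpaceForm.metric (p₀ : Quadric N l c) : SemiRiemannianMetric (𝓡 N) (SpaceForm p₀) where
  val q := pullbackForm (flatForm N l c) (mvfderiv (𝓡 N) (SpaceForm.incl p₀) q)
  symm q v w := Quadric.form_symm _ _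
  nondegenerate q v h := by
    have hd (u : TangentSpace (𝓡 N) q) : mvfderiv (𝓡 N) (SpaceForm.incl p₀) q u
        = ((Quadric.orthEquiv q.1).symm u : EuclideanSpace ℝ (Fin (N + 1))) :=
      congr($((SpaceForm.hasMFDerivAt_incl p₀ q).mfderiv) u)
    have h1 (u : TangentSpace (𝓡 N) q) : flatForm N l c
        ((Quadric.orthEquiv q.1).symm v : EuclideanSpace ℝ (Fin (N + 1)))
        ((Quadric.orthEquiv q.1).symm u : EuclideanSpace ℝ (Fin (N + 1))) = 0 := by
      rw [← hd, ← hd]; exact h u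
    have h2 : ((Quadric.orthEquiv q.1).symm v : EuclideanSpace ℝ (Fin (N + 1))) = 0 := by
      refine pseudoEuclidean_nondegenerate (N + 1) (if c = 1 then l else l + 1) _ fun y ↦ ?_
      have h3 := h1 (Quadric.orthEquiv q.1 (Quadric.orthProj q.1 y))
      rw [ContinuousLinearEquiv.symm_apply_apply, Quadric.coe_orthProj, map_sub, map_smul,
        Quadric.form_symm _ q.1.val, Quadric.mem_orth.1 ((Quadric.orthEquiv q.1).symm v).2,
        smul_zero, sub_zero] at h3
      exact h3
    have h4 : (Quadric.orthEquiv q.1).symm v = 0 := Subtype.ext h2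
    exact (Quadric.orthEquiv q.1).symm.map_eq_zero_iff.1 h4
  contMDiff := contMDiff_pullback (contMDiff_constForm (flatForm N l c))
    (SpaceForm.contMDiff_incl p₀)

end SpaceForm

end

/-!
The coordinate field `∂ₜ` of a warped product is closed and conformal. Extend tangent vectors to
fields with constant components in a chart, so that all brackets vanish at the base point. The
one-form `⟨∂ₜ, ·⟩ = ε dt` is constant on such extensions, which makes `⟨∇̄_V ∂ₜ, W⟩` symmetric
in `V` and `W`; hence `2 ⟨∇̄_V ∂ₜ, W⟩ = ∂ₜ ⟨V, W⟩ = 2 a a' g(V, W)`, the fibre metric being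
independent of `t`. Since `ε dt` is dual to `∂ₜ`, the field `T = ε grad π` is the tangential
part of `∂ₜ` along the immersion, and `ξ` is its normal part. The formulas for `T` and `ξ` are
then the tangential and the normal components of the derivative of `∂ₜ`, separated by the Gauss
and Weingarten formulas.
-/

section Along

variable {M : Type*} {F : Type*} [NormedAddCommGroup F] [NormedSpace ℝ F]
  {G : Type*} [TopologicalSpace G] {J : ModelWithCorners ℝ F G}
  {P : Type*} [TopologicalSpace P] [ChartedSpace G P]

section Coords

variable [IsManifold J 1 P]

/-- The components, in the local frame of `TP` around `f x`, of a vector field `σ` along `f`.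
They are set to zero where `f` leaves the domain of the frame, which makes them linear in `σ`. -/
noncomputable def coordsAlong (f : M → P) (x : M) (σ : Π y, TangentSpace J (f y)) (y : M) : F :=
  (trivializationAt F (TangentSpace J) (f x)).continuousLinearMapAt ℝ (f y) (σ y)

variable {f : M → P} {σ τ : Π y, TangentSpace J (f y)} {h : M → ℝ} {x : M}

theorem coordsAlong_add : coordsAlong f x (σ + τ) = coordsAlong f x σ + coordsAlong f x τ := by
  ext; simp [coordsAlong]

theorem coordsAlong_smul : coordsAlong f x (h • σ) = h • coordsAlong f x σ := by
  ext; simp [coordsAlong]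

theorem symmL_coordsAlong {y : M}
    (hy : f y ∈ (trivializationAt F (TangentSpace J) (f x)).baseSet) :
    (trivializationAt F (TangentSpace J) (f x)).symmL ℝ (f y) (coordsAlong f x σ y) = σ y :=
  (trivializationAt F (TangentSpace J) (f x)).symmL_continuousLinearMapAt hy (σ y)

end Coords

variable {E : Type*} [NormedAddCommGroup E] [NormedSpace ℝ E]
  {H : Type*} [TopologicalSpace H] {I : ModelWithCorners ℝ E H}
  [TopologicalSpace M] [ChartedSpace H M]
  {f : M → P} {σ τ : Π y, TangentSpace J (f y)} {h : M → ℝ} {x : M}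

section Differentiability

variable [IsManifold J 1 P]

variable (I) in
/-- Differentiability at `x` of a vector field `σ` along `f`, as a map into the tangent bundle. -/
abbrev MDiffAlongAt (f : M → P) (σ : Π y, TangentSpace J (f y)) (x : M) : Prop :=
  MDifferentiableAt I J.tangent (fun y ↦ TotalSpace.mk' F (f y) (σ y)) x

theorem eventually_mem_baseSet (hf : ContinuousAt f x) :
    ∀ᶠ y in 𝓝 x, f y ∈ (trivializationAt F (TangentSpace J) (f x)).baseSet :=
  hf.eventually ((trivializationAt F (TangentSpace J) (f x)).open_baseSet.eventually_mem
    (mem_baseSet_trivializationAt' (f x)))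

theorem coordsAlong_eventuallyEq (hf : ContinuousAt f x) :
    coordsAlong f x σ =ᶠ[𝓝 x] fun y ↦
      (trivializationAt F (TangentSpace J) (f x) (TotalSpace.mk' F (f y) (σ y))).2 := by
  filter_upwards [eventually_mem_baseSet (J := J) hf] with y hy
  simp only [coordsAlong, Trivialization.continuousLinearMapAt_apply,
    Trivialization.linearMapAt_apply, if_pos hy]

theorem mdiffAlongAt_iff : MDiffAlongAt I f σ x ↔
    MDifferentiableAt I J f x ∧ MDifferentiableAt I 𝓘(ℝ, F) (coordsAlong f x σ) x := by
  rw [MDiffAlongAt, mdifferentiableAt_totalSpace]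
  exact and_congr_right fun hf ↦
    (coordsAlong_eventuallyEq hf.continuousAt).mdifferentiableAt_iff.symm

namespace MDiffAlongAt

theorem base (hσ : MDiffAlongAt I f σ x) : MDifferentiableAt I J f x :=
  (mdiffAlongAt_iff.1 hσ).1

theorem coords (hσ : MDiffAlongAt I f σ x) :
    MDifferentiableAt I 𝓘(ℝ, F) (coordsAlong f x σ) x :=
  (mdiffAlongAt_iff.1 hσ).2

theorem add (hσ : MDiffAlongAt I f σ x) (hτ : MDiffAlongAt I f τ x) :
    MDiffAlongAt I f (σ + τ) x :=
  mdiffAlongAt_iff.2 ⟨hσ.base, coordsAlong_add (σ := σ) (τ := τ) ▸ hσ.coords.add hτ.coords⟩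

theorem smul (hh : MDiffAt h x) (hσ : MDiffAlongAt I f σ x) : MDiffAlongAt I f (h • σ) x :=
  mdiffAlongAt_iff.2 ⟨hσ.base, coordsAlong_smul (σ := σ) (h := h) ▸ hh.smul hσ.coords⟩

end MDiffAlongAt

end Differentiability

variable [IsManifold J ∞ P] {nabla : CovariantDerivative J F (TangentSpace J : P → Type _)}

theorem covAlong_apply (hf : ContinuousAt f x) (v : TangentSpace I x) :
    covAlong nabla f σ x v =
      (trivializationAt F (TangentSpace J) (f x)).symmL ℝ (f x)
        (mvfderiv I (coordsAlong f x σ) x v)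
      + nabla (localExtension (σ x)) (f x) (mfderiv I J f x v) := by
  rw [mvfderiv_congr (coordsAlong_eventuallyEq hf)]
  rfl

theorem covAlong_smul (hh : MDiffAt h x) (hσ : MDiffAlongAt I f σ x) (v : TangentSpace I x) :
    covAlong nabla f (h • σ) x v = h x • covAlong nabla f σ x v + mvfderiv I h x v • σ x := by
  have hf := hσ.base.continuousAt
  rw [covAlong_apply hf, covAlong_apply hf, coordsAlong_smul, mvfderiv_smul hh hσ.coords,
    Pi.smul_apply', localExtension_smul,
    nabla.isCovariantDerivativeOn.smul_const _ (mdiffAt_localExtension _)]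
  simp only [_root_.add_apply, _root_.smul_apply, ContinuousLinearMap.smulRight_apply, map_add,
    map_smul, symmL_coordsAlong (mem_baseSet_trivializationAt' (f x)), smul_add]
  abel

end Along

section Compatibility

variable {E : Type*} [NormedAddCommGroup E] [NormedSpace ℝ E]
  {H : Type*} [TopologicalSpace H] {I : ModelWithCorners ℝ E H}
  {M : Type*} [TopologicalSpace M] [ChartedSpace H M] {x : M}

section Product

variable {V W U : Type*} [NormedAddCommGroup V] [NormedSpace ℝ V]
  [NormedAddCommGroup W] [NormedSpace ℝ W] [NormedAddCommGroup U] [NormedSpace ℝ U]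

theorem mvfderiv_clm_apply {A : M → V →L[ℝ] W} {s : M → V} (hA : MDiffAt A x) (hs : MDiffAt s x)
    (v : TangentSpace I x) :
    mvfderiv I (fun y ↦ A y (s y)) x v = mvfderiv I A x v (s x) + A x (mvfderiv I s x v) := by
  have hAs : HasMFDerivAt I 𝓘(ℝ, (V →L[ℝ] W) × V) (fun y ↦ (A y, s y)) x
      ((mvfderiv I A x).prod (mvfderiv I s x)) :=
    ⟨hA.continuousAt.prodMk hs.continuousAt, hA.hasMFDerivAt.2.prodMk hs.hasMFDerivAt.2⟩
  have h := HasMFDerivAt.comp x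
    (isBoundedBilinearMap_apply.hasFDerivAt (A x, s x)).hasMFDerivAt hAs
  exact congr($(h.mfderiv) v).trans (add_comm _ _)

theorem mvfderiv_clm_apply₂ {A : M → V →L[ℝ] W →L[ℝ] U} {s : M → V} {t : M → W}
    (hA : MDiffAt A x) (hs : MDiffAt s x) (ht : MDiffAt t x) (v : TangentSpace I x) :
    mvfderiv I (fun y ↦ A y (s y) (t y)) x v = mvfderiv I A x v (s x) (t x)
      + A x (mvfderiv I s x v) (t x) + A x (s x) (mvfderiv I t x v) := by
  rw [mvfderiv_clm_apply (hA.clm_apply hs) ht, mvfderiv_clm_apply hA hs, _root_.add_apply]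

end Product

variable {F : Type*} [NormedAddCommGroup F] [NormedSpace ℝ F]
  {G : Type*} [TopologicalSpace G] {J : ModelWithCorners ℝ F G}
  {P : Type*} [TopologicalSpace P] [ChartedSpace G P] [IsManifold J ∞ P]
  {g : SemiRiemannianMetric J P} {nabla : CovariantDerivative J F (TangentSpace J : P → Type _)}

namespace SemiRiemannianMetric

/-- The metric at `y`, read in the local frame of the tangent bundle around `p`. -/
noncomputable def gram (g : SemiRiemannianMetric J P) (p y : P) : F →L[ℝ] F →L[ℝ] ℝ :=
  pullbackForm (g.val y) ((trivializationAt F (TangentSpace J) p).symmL ℝ y)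

theorem contMDiffAt_gram (g : SemiRiemannianMetric J P) (p : P) :
    ContMDiffAt J 𝓘(ℝ, F →L[ℝ] F →L[ℝ] ℝ) ∞ (g.gram p) p := by
  refine ((contMDiffAt_section _).1 (g.contMDiff p)).congr_of_eventuallyEq ?_
  filter_upwards [(trivializationAt F (TangentSpace J) p).open_baseSet.eventually_mem
    (mem_baseSet_trivializationAt' p)] with y hy
  ext u w
  simp only [hom_trivializationAt_apply, ContinuousLinearMap.inCoordinates,
    ContinuousLinearMap.comp_apply, Trivialization.continuousLinearMapAt_apply]
  rw [linearMapAt_dual_apply hy]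
  rfl

theorem mdifferentiableAt_gram (g : SemiRiemannianMetric J P) (p : P) : MDiffAt (g.gram p) p :=
  (g.contMDiffAt_gram p).mdifferentiableAt (by simp)

variable {f : M → P} {σ τ : Π y, TangentSpace J (f y)}

theorem val_eventuallyEq_gram (g : SemiRiemannianMetric J P) (hf : ContinuousAt f x) :
    (fun y ↦ g.val (f y) (σ y) (τ y)) =ᶠ[𝓝 x]
      fun y ↦ g.gram (f x) (f y) (coordsAlong f x σ y) (coordsAlong f x τ y) := by
  filter_upwards [eventually_mem_baseSet (J := J) hf] with y hy
  rw [gram, pullbackForm_apply, symmL_coordsAlong hy, symmL_coordsAlong hy]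

theorem mdifferentiableAt_val_along (g : SemiRiemannianMetric J P)
    (hσ : MDiffAlongAt I f σ x) (hτ : MDiffAlongAt I f τ x) :
    MDiffAt (fun y ↦ g.val (f y) (σ y) (τ y)) x :=
  ((((g.mdifferentiableAt_gram (f x)).comp x hσ.base).clm_apply hσ.coords).clm_apply
    hτ.coords).congr_of_eventuallyEq (g.val_eventuallyEq_gram hσ.base.continuousAt)

end SemiRiemannianMetric

namespace IsLeviCivita

theorem mvfderiv_gram (hnabla : IsLeviCivita g nabla) {p : P} (u v w : TangentSpace J p) :
    mvfderiv J (g.gram p) p u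
        ((trivializationAt F (TangentSpace J) p).continuousLinearMapAt ℝ p v)
        ((trivializationAt F (TangentSpace J) p).continuousLinearMapAt ℝ p w)
      = g.val p (nabla (localExtension v) p u) w + g.val p v (nabla (localExtension w) p u) := by
  have h := hnabla.compatible _ _ p u (mdiffAt_localExtension v) (mdiffAt_localExtension w)
  rw [localExtension_self, localExtension_self] at h
  rw [← h]
  refine .trans ?_ (mvfderiv_clm_apply₂ (g.mdifferentiableAt_gram p) mdifferentiableAt_const
    mdifferentiableAt_const u).symm
  simp [mvfderiv_const]

theorem mvfderiv_val_along (hnabla : IsLeviCivita g nabla)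
    {f : M → P} {σ τ : Π y, TangentSpace J (f y)}
    (hσ : MDiffAlongAt I f σ x) (hτ : MDiffAlongAt I f τ x) (v : TangentSpace I x) :
    mvfderiv I (fun y ↦ g.val (f y) (σ y) (τ y)) x v
      = g.val (f x) (covAlong nabla f σ x v) (τ x)
        + g.val (f x) (σ x) (covAlong nabla f τ x v) := by
  have hf := hσ.base.continuousAt
  have hx := mem_baseSet_trivializationAt' (F := F) (E := TangentSpace J) (f x)
  have hgram := g.mdifferentiableAt_gram (f x)
  have hchain : mvfderiv I (g.gram (f x) ∘ f) x v
      = mvfderiv J (g.gram (f x)) (f x) (mfderiv I J f x v) :=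
    mfderiv_comp_apply x hgram hσ.base v
  rw [mvfderiv_congr (g.val_eventuallyEq_gram hf)]
  calc _ = _ := mvfderiv_clm_apply₂ (A := g.gram (f x) ∘ f) (hgram.comp x hσ.base)
        hσ.coords hτ.coords v
    _ = _ := by
      rw [hchain, coordsAlong, coordsAlong, hnabla.mvfderiv_gram]
      simp only [Function.comp_apply, SemiRiemannianMetric.gram, pullbackForm_apply,
        covAlong_apply hf, Trivialization.symmL_continuousLinearMapAt _ hx, map_add,
        _root_.add_apply]
      ring

end IsLeviCivita

end Compatibility

section CoordinateConstant

variable {E : Type*} [NormedAddCommGroup E] [NormedSpace ℝ E]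
  {H : Type*} [TopologicalSpace H] {I : ModelWithCorners ℝ E H}
  {M : Type*} [TopologicalSpace M] [ChartedSpace H M]
  {F : Type*} [NormedAddCommGroup F] [NormedSpace ℝ F]
  {G : Type*} [TopologicalSpace G] {J : ModelWithCorners ℝ F G}
  {P : Type*} [TopologicalSpace P] [ChartedSpace G P]

section Bracket

variable [IsManifold J 1 P] {p : P}

theorem mpullbackWithin_extChartAt_symm_localExtension (v : TangentSpace J p) :
    VectorField.mpullbackWithin 𝓘(ℝ, F) J (extChartAt J p).symm (localExtension v) (Set.range J)
      =ᶠ[𝓝[Set.range J] (extChartAt J p p)]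
      fun _ ↦ (trivializationAt F (TangentSpace J) p).continuousLinearMapAt ℝ p v := by
  filter_upwards [extChartAt_target_mem_nhdsWithin (I := J) p] with z hz
  have hsource : (extChartAt J p).symm z ∈ (chartAt G p).source := by
    rw [← extChartAt_source J]
    exact (extChartAt J p).map_target hz
  obtain ⟨e, he⟩ := isInvertible_mfderivWithin_extChartAt_symm (I := J) hz
  rw [VectorField.mpullbackWithin_apply, localExtension,
    TangentBundle.symmL_trivializationAt hsource, (extChartAt J p).right_inv hz, ← he,
    ContinuousLinearMap.inverse_equiv]
  exact e.symm_apply_apply _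

theorem mlieBracket_localExtension (v w : TangentSpace J p) :
    VectorField.mlieBracket J (localExtension v) (localExtension w) p = 0 := by
  rw [← VectorField.mlieBracketWithin_univ, VectorField.mlieBracketWithin_apply,
    Set.preimage_univ, Set.univ_inter,
    (mpullbackWithin_extChartAt_symm_localExtension v).lieBracketWithin_vectorField_eq_of_mem
      (mpullbackWithin_extChartAt_symm_localExtension w) (Set.mem_range_self _)]
  simp only [VectorField.lieBracketWithin, fderivWithin_fun_const, Pi.zero_apply,
    _root_.zero_apply, sub_self]
  exact map_zero _

end Bracket

theorem IsLeviCivita.localExtension_comm [IsManifold J ∞ P] {g : SemiRiemannianMetric J P}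
    {nabla : CovariantDerivative J F (TangentSpace J : P → Type _)} (hnabla : IsLeviCivita g nabla)
    {p : P} (v w : TangentSpace J p) :
    nabla (localExtension v) p w = nabla (localExtension w) p v := by
  have h := hnabla.torsion_free (localExtension w) (localExtension v) p
    (mdiffAt_localExtension w) (mdiffAt_localExtension v)
  rwa [mlieBracket_localExtension, localExtension_self, localExtension_self, sub_eq_zero] at h

theorem IsLeviCivita.two_mul_val_localExtension [IsManifold J ∞ P] {g : SemiRiemannianMetric J P}
    {nabla : CovariantDerivative J F (TangentSpace J : P → Type _)}
    (hnabla : IsLeviCivita g nabla) {p : P} {u : TangentSpace J p}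
    (hclosed : ∀ v w : TangentSpace J p,
      mvfderiv J (fun y ↦ g.val y (localExtension u y) (localExtension w y)) p v
        = mvfderiv J (fun y ↦ g.val y (localExtension u y) (localExtension v y)) p w)
    (v w : TangentSpace J p) :
    2 * g.val p (nabla (localExtension u) p v) w
      = mvfderiv J (fun y ↦ g.val y (localExtension v y) (localExtension w y)) p u := by
  have hcompat (u v w : TangentSpace J p) :
      mvfderiv J (fun y ↦ g.val y (localExtension v y) (localExtension w y)) p u
        = g.val p (nabla (localExtension v) p u) w + g.val p v (nabla (localExtension w) p u) := by
    simpa only [localExtension_self] using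
      hnabla.compatible _ _ p u (mdiffAt_localExtension v) (mdiffAt_localExtension w)
  have hsymm := hclosed v w
  rw [hcompat, hcompat, hnabla.localExtension_comm w v] at hsymm
  rw [hcompat, hnabla.localExtension_comm v u, hnabla.localExtension_comm w u, g.symm p v]
  linear_combination hsymm

variable [IsManifold I ∞ M] [IsManifold J ∞ P] {f : M → P} {x : M}

theorem inTangentCoordinates_mfderiv_eventuallyEq (hf : MDifferentiable I J f) :
    inTangentCoordinates I J id f (mfderiv I J f) x =ᶠ[𝓝 x] fun y ↦
      fderivWithin ℝ (writtenInExtChartAt I J x f) (Set.range I) (extChartAt I x y) := by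
  filter_upwards [hf.continuous.continuousAt.preimage_mem_nhds (chart_source_mem_nhds G (f x)),
    chart_source_mem_nhds H x] with y hfy hy
  have hsource : y ∈ (extChartAt I x).source := extChartAt_source I x ▸ hy
  have hz := (extChartAt I x).map_source hsource
  have hchart : MDifferentiableAt J 𝓘(ℝ, F) (extChartAt J (f x)) (f y) :=
    mdifferentiableAt_extChartAt hfy
  have hsymm := mdifferentiableWithinAt_extChartAt_symm (I := I) hz
  have huniq := I.uniqueMDiffOn _ (extChartAt_target_subset_range x hz)
  have hinv := (extChartAt I x).left_inv hsource
  rw [inTangentCoordinates_eq_mfderiv_comp hy hfy, ← mfderivWithin_eq_fderivWithin]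
  calc _ = ((mfderiv J 𝓘(ℝ, F) (extChartAt J (f x)) (f y)).comp (mfderiv I J f y)).comp
        (mfderivWithin 𝓘(ℝ, E) I (extChartAt I x).symm (Set.range I) (extChartAt I x y)) := rfl
    _ = _ := by
      rw [← mfderiv_comp y hchart (hf y),
        ← mfderiv_comp_mfderivWithin_of_eq (hchart.comp y (hf y)) hsymm huniq hinv]
      rfl

theorem mvfderiv_coordsAlong_mfderiv_localExtension (hf : ContMDiff I J ∞ f)
    (v w : TangentSpace I x) :
    mvfderiv I (coordsAlong f x fun y ↦ mfderiv I J f y (localExtension v y)) x w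
      = fderivWithin ℝ (fderivWithin ℝ (writtenInExtChartAt I J x f) (Set.range I)) (Set.range I)
        (extChartAt I x x) ((trivializationAt E (TangentSpace I) x).continuousLinearMapAt ℝ x w)
        ((trivializationAt E (TangentSpace I) x).continuousLinearMapAt ℝ x v) := by
  set D := fderivWithin ℝ (writtenInExtChartAt I J x f) (Set.range I)
  have hD : DifferentiableWithinAt ℝ D (Set.range I) (extChartAt I x x) :=
    ((contMDiffAt_iff.1 (hf x)).2.fderivWithin_right (m := 1) I.uniqueDiffOn (by norm_cast)
      (Set.mem_range_self _)).differentiableWithinAt one_ne_zero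
  have hchart : MDifferentiableAt I 𝓘(ℝ, E) (extChartAt I x) x :=
    mdifferentiableAt_extChartAt (mem_chart_source H x)
  have hcomp : HasMFDerivAt I 𝓘(ℝ, E →L[ℝ] F) (D ∘ extChartAt I x) x _ :=
    hasMFDerivWithinAt_univ.1 <| hD.hasFDerivWithinAt.hasMFDerivWithinAt.comp x
      hchart.hasMFDerivAt.hasMFDerivWithinAt fun _ _ ↦ Set.mem_range_self _
  have hcoords : (coordsAlong f x fun y ↦ mfderiv I J f y (localExtension v y)) =ᶠ[𝓝 x]
      fun y ↦ (D ∘ extChartAt I x) y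
        ((trivializationAt E (TangentSpace I) x).continuousLinearMapAt ℝ x v) :=
    (inTangentCoordinates_mfderiv_eventuallyEq (hf.mdifferentiable (by simp))).fun_comp (· _)
  rw [mvfderiv_congr hcoords, mvfderiv_clm_apply hcomp.mdifferentiableAt mdifferentiableAt_const,
    mvfderiv_const, TangentBundle.continuousLinearMapAt_trivializationAt (mem_chart_source H x)]
  refine (add_eq_left.2 (map_zero _)).trans ?_
  exact DFunLike.congr_fun (show _ = (_ : E →L[ℝ] F) from congr($(hcomp.mfderiv) w)) _

theorem covAlong_mfderiv_localExtension_comm {g : SemiRiemannianMetric J P}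
    {nabla : CovariantDerivative J F (TangentSpace J : P → Type _)} (hnabla : IsLeviCivita g nabla)
    (hf : ContMDiff I J ∞ f) (v w : TangentSpace I x) :
    covAlong nabla f (fun y ↦ mfderiv I J f y (localExtension v y)) x w
      = covAlong nabla f (fun y ↦ mfderiv I J f y (localExtension w y)) x v := by
  have hsymm : IsSymmSndFDerivWithinAt ℝ (writtenInExtChartAt I J x f) (Set.range I)
      (extChartAt I x x) :=
    (contMDiffAt_iff.1 (hf x)).2.isSymmSndFDerivWithinAt (by simp; norm_cast) I.uniqueDiffOn
      (I.range_subset_closure_interior (Set.mem_range_self _)) (Set.mem_range_self _)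
  have hcont := hf.continuous.continuousAt (x := x)
  rw [covAlong_apply hcont, covAlong_apply hcont, mvfderiv_coordsAlong_mfderiv_localExtension hf,
    mvfderiv_coordsAlong_mfderiv_localExtension hf, hsymm.eq, localExtension_self,
    localExtension_self, hnabla.localExtension_comm]

end CoordinateConstant

section Koszul

theorem eq_zero_of_symm_of_antisymm {V R : Type*} [CommRing R] [LinearOrder R]
    [IsStrictOrderedRing R] {D : V → V → V → R} (hsymm : ∀ u v w, D u v w = D v u w)
    (hanti : ∀ u v w, D u v w = -D u w v) (u v w : V) : D u v w = 0 := by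
  linarith [hsymm u v w, hanti v u w, hsymm v w u, hanti w v u, hsymm w u v, hanti u w v]

end Koszul

section Tangential

variable {E : Type*} [NormedAddCommGroup E] [NormedSpace ℝ E] [FiniteDimensional ℝ E]
  {H : Type*} [TopologicalSpace H] {I : ModelWithCorners ℝ E H}
  {M : Type*} [TopologicalSpace M] [ChartedSpace H M] {x : M}

theorem mdifferentiableAt_clm_of_apply {W : Type*} [NormedAddCommGroup W] [NormedSpace ℝ W]
    {A : M → E →L[ℝ] W} (hA : ∀ v, MDiffAt (fun y ↦ A y v) x) :
    MDiffAt A x := by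
  let b := Module.finBasis ℝ E
  let e (i) : W →L[ℝ] E →L[ℝ] W :=
    ContinuousLinearMap.smulRightL ℝ E W (b.coord i).toContinuousLinearMap
  have hsum : A = ∑ i, fun y ↦ e i (A y (b i)) := by
    ext y v
    conv_lhs => rw [← b.sum_repr v, map_sum]
    simp [e]
  rw [hsum]
  exact .sum fun i _ ↦ (e i).mdifferentiableAt.comp x (hA (b i))

variable [IsManifold I ∞ M]

theorem SemiRiemannianMetric.isInvertible_gram (g : SemiRiemannianMetric I M) {p y : M}
    (hy : y ∈ (trivializationAt E (TangentSpace I) p).baseSet) : (g.gram p y).IsInvertible := by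
  have hinj : Function.Injective (g.gram p y) := by
    refine (injective_iff_map_eq_zero _).2 fun u hu ↦ ?_
    rw [← (trivializationAt E (TangentSpace I) p).continuousLinearMapAt_symmL (R := ℝ) hy u,
      g.nondegenerate y ((trivializationAt E (TangentSpace I) p).symmL ℝ y u) fun w ↦ ?_, map_zero]
    rw [← (trivializationAt E (TangentSpace I) p).symmL_continuousLinearMapAt (R := ℝ) hy w]
    exact congr($hu _)
  have hrank : Module.finrank ℝ E = Module.finrank ℝ (E →L[ℝ] ℝ) :=
    Subspace.dual_finrank_eq.symm.trans LinearMap.toContinuousLinearMap.finrank_eq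
  exact ⟨(LinearEquiv.ofInjectiveOfFinrankEq (g.gram p y).toLinearMap hinj
    hrank).toContinuousLinearEquiv, rfl⟩

theorem SemiRiemannianMetric.mdiffAt_of_val_localExtension (g : SemiRiemannianMetric I M)
    {Y : Π y : M, TangentSpace I y}
    (hY : ∀ v : TangentSpace I x, MDiffAt (fun y ↦ g.val y (Y y) (localExtension v y)) x) :
    MDiffAt (T% Y) x := by
  refine mdiffAlongAt_iff (f := id).2 ⟨mdifferentiableAt_id, ?_⟩
  have hx := mem_baseSet_trivializationAt' (F := E) (E := TangentSpace I) x
  have hcovector : MDiffAt (fun y ↦ g.gram x y (coordsAlong id x Y y)) x := by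
    refine mdifferentiableAt_clm_of_apply fun v ↦ ?_
    refine (hY ((trivializationAt E (TangentSpace I) x).symmL ℝ x v)).congr_of_eventuallyEq ?_
    filter_upwards [eventually_mem_baseSet (J := I) continuousAt_id] with y hy
    rw [localExtension, Trivialization.continuousLinearMapAt_symmL _ hx]
    exact congr(g.val y $(symmL_coordsAlong (f := id) hy) _)
  have hinverse : MDiffAt (fun y ↦ (g.gram x y).inverse) x :=
    (((g.isInvertible_gram hx).contDiffAt_map_inverse (n := 1)).differentiableAt
      one_ne_zero).mdifferentiableAt.comp x (g.mdifferentiableAt_gram x)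
  refine (hinverse.clm_apply hcovector).congr_of_eventuallyEq ?_
  filter_upwards [eventually_mem_baseSet (J := I) continuousAt_id] with y hy
  exact ((g.isInvertible_gram hy).inverse_apply_self _).symm

end Tangential

section Submanifold

variable {E : Type*} [NormedAddCommGroup E] [NormedSpace ℝ E]
  {H : Type*} [TopologicalSpace H] {I : ModelWithCorners ℝ E H}
  {M : Type*} [TopologicalSpace M] [ChartedSpace H M] [IsManifold I ∞ M]
  {F : Type*} [NormedAddCommGroup F] [NormedSpace ℝ F]
  {G : Type*} [TopologicalSpace G] {J : ModelWithCorners ℝ F G}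
  {P : Type*} [TopologicalSpace P] [ChartedSpace G P] [IsManifold J ∞ P]
  {g : SemiRiemannianMetric I M} {gP : SemiRiemannianMetric J P} {x : M}

namespace IsometricImmersion

theorem push_add (f : IsometricImmersion g gP) (Y Z : Π x : M, TangentSpace I x) :
    f.push (Y + Z) = f.push Y + f.push Z := by
  ext y; simp [push]

theorem push_smul (f : IsometricImmersion g gP) (h : M → ℝ) (Y : Π x : M, TangentSpace I x) :
    f.push (h • Y) = h • f.push Y := by
  ext y; simp [push]

variable [FiniteDimensional ℝ E]

theorem val_tangential (f : IsometricImmersion g gP) (w : TangentSpace J (f.toFun x))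
    (v : TangentSpace I x) :
    g.val x (f.tangential x w) v = gP.val (f.toFun x) w (mfderiv I J f.toFun x v) :=
  g.val_sharp x _ v

theorem mfderiv_tangential_add_normal (f : IsometricImmersion g gP)
    (w : TangentSpace J (f.toFun x)) :
    mfderiv I J f.toFun x (f.tangential x w) + f.normal x w = w :=
  add_sub_cancel _ w

theorem tangential_mfderiv (f : IsometricImmersion g gP) (v : TangentSpace I x) :
    f.tangential x (mfderiv I J f.toFun x v) = v :=
  g.eq_of_val_eq fun w ↦ by rw [val_tangential, f.isometric]

theorem normal_mfderiv (f : IsometricImmersion g gP) (v : TangentSpace I x) :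
    f.normal x (mfderiv I J f.toFun x v) = 0 :=
  sub_eq_zero.2 congr(mfderiv I J f.toFun x $(f.tangential_mfderiv v)).symm

namespace IsNormal

variable {f : IsometricImmersion g gP} {w : TangentSpace J (f.toFun x)}

theorem tangential_eq_zero (hw : f.IsNormal x w) : f.tangential x w = 0 :=
  g.nondegenerate x _ fun v ↦ (f.val_tangential w v).trans (hw v)

theorem normal_eq_self (hw : f.IsNormal x w) : f.normal x w = w := by
  simpa only [hw.tangential_eq_zero, map_zero, zero_add] using f.mfderiv_tangential_add_normal w

end IsNormal

section Differentiability

variable {f : IsometricImmersion g gP} {σ : Π y, TangentSpace J (f.toFun y)}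

theorem mdiffAt_tangential (hσ : MDiffAlongAt I f.toFun σ x) :
    MDiffAt (T% fun y ↦ f.tangential y (σ y)) x :=
  g.mdiffAt_of_val_localExtension fun v ↦ by
    simp only [val_tangential]
    exact gP.mdifferentiableAt_val_along hσ (f.mdiffAt_push (mdiffAt_localExtension v))

theorem mdiffAlongAt_normal (hσ : MDiffAlongAt I f.toFun σ x) :
    MDiffAlongAt I f.toFun (fun y ↦ f.normal y (σ y)) x := by
  have hneg : (fun y ↦ f.normal y (σ y))
      = σ + (fun _ : M ↦ (-1 : ℝ)) • f.push fun y ↦ f.tangential y (σ y) := by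
    ext y; simp [normal, push, sub_eq_add_neg]
  rw [hneg]
  exact hσ.add (.smul mdifferentiableAt_const (f.mdiffAt_push (mdiffAt_tangential hσ)))

end Differentiability

variable {nabla : CovariantDerivative I E (TangentSpace I : M → Type _)}
  {nablaP : CovariantDerivative J F (TangentSpace J : P → Type _)}

theorem val_shapeOperator (f : IsometricImmersion g gP) (η : TangentSpace J (f.toFun x))
    (u v : TangentSpace I x) : g.val x (f.shapeOperator nablaP x η u) v
      = gP.val (f.toFun x) η (f.secondFundamentalForm nablaP x u v) :=
  g.val_sharp x _ v

theorem isNormal_secondFundamentalForm (f : IsometricImmersion g gP) (u v : TangentSpace I x) :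
    f.IsNormal x (f.secondFundamentalForm nablaP x u v) :=
  f.normal_orthogonal x _

theorem tangential_covAlong_push_localExtension (f : IsometricImmersion g gP)
    (hnabla : IsLeviCivita g nabla) (hnablaP : IsLeviCivita gP nablaP) (u v : TangentSpace I x) :
    f.tangential x (covAlong nablaP f.toFun (f.push (localExtension v)) x u)
      = nabla (localExtension v) x u := by
  let D (u v w : TangentSpace I x) : ℝ :=
    gP.val (f.toFun x) (covAlong nablaP f.toFun (f.push (localExtension v)) x u)
      (mfderiv I J f.toFun x w) - g.val x (nabla (localExtension v) x u) w
  have hsymm (u v w) : D u v w = D v u w := by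
    have hcomm : covAlong nablaP f.toFun (f.push (localExtension v)) x u
        = covAlong nablaP f.toFun (f.push (localExtension u)) x v :=
      covAlong_mfderiv_localExtension_comm hnablaP f.contMDiff v u
    simp only [D, hcomm, hnabla.localExtension_comm u v]
  have hanti (u v w) : D u v w = -D u w v := by
    have hM := hnabla.compatible _ _ x u (mdiffAt_localExtension v) (mdiffAt_localExtension w)
    have hP := hnablaP.mvfderiv_val_along (f.mdiffAt_push (mdiffAt_localExtension v))
      (f.mdiffAt_push (mdiffAt_localExtension w)) u
    have hisometric : (fun y ↦ gP.val (f.toFun y) (f.push (localExtension v) y)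
        (f.push (localExtension w) y))
        = fun y ↦ g.val y (localExtension v y) (localExtension w y) :=
      funext fun y ↦ f.isometric y _ _
    rw [hisometric, hM] at hP
    simp only [push, localExtension_self] at hP
    simp only [D]
    rw [g.symm x v, gP.symm _ (mfderiv I J f.toFun x v)] at hP
    linear_combination -hP
  refine g.eq_of_val_eq fun w ↦ ?_
  rw [val_tangential]
  exact sub_eq_zero.1 (eq_zero_of_symm_of_antisymm hsymm hanti u v w)

theorem gauss_formula (f : IsometricImmersion g gP) (hnabla : IsLeviCivita g nabla)
    (hnablaP : IsLeviCivita gP nablaP) {Y : Π x : M, TangentSpace I x}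
    (hY : MDiffAt (T% Y) x) (X : TangentSpace I x) :
    covAlong nablaP f.toFun (f.push Y) x X
      = mfderiv I J f.toFun x (nabla Y x X) + f.secondFundamentalForm nablaP x X (Y x) := by
  let Φ (Z : Π x : M, TangentSpace I x) : TangentSpace J (f.toFun x) :=
    covAlong nablaP f.toFun (f.push Z) x X - mfderiv I J f.toFun x (nabla Z x X)
  have hΦ : TensorialAt I E Φ x := by
    refine ⟨fun {h Z} hh hZ ↦ ?_, fun {Z Z'} hZ hZ' ↦ ?_⟩
    · simp only [Φ]
      rw [push_smul, covAlong_smul hh (f.mdiffAt_push hZ),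
        nabla.isCovariantDerivativeOn.leibniz hZ hh]
      simp [push, smul_sub]
    · simp only [Φ]
      rw [push_add, covAlong_add nablaP (f.mdiffAt_push hZ) (f.mdiffAt_push hZ'),
        nabla.isCovariantDerivativeOn.add hZ hZ']
      simp only [_root_.add_apply, map_add]
      abel
  have hα : Φ (localExtension (Y x)) = f.secondFundamentalForm nablaP x X (Y x) := by
    simp only [Φ, ← f.tangential_covAlong_push_localExtension hnabla hnablaP]
    rfl
  rw [← hα, ← hΦ.pointwise hY (mdiffAt_localExtension _) (localExtension_self _).symm]
  exact (add_sub_cancel _ _).symm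

theorem weingarten_formula (f : IsometricImmersion g gP) (hnablaP : IsLeviCivita gP nablaP)
    {η : Π x : M, TangentSpace J (f.toFun x)} (hη : MDiffAlongAt I f.toFun η x)
    (hn : ∀ y, f.IsNormal y (η y)) (X : TangentSpace I x) :
    f.tangential x (covAlong nablaP f.toFun η x X) = -f.shapeOperator nablaP x (η x) X := by
  refine g.eq_of_val_eq fun v ↦ ?_
  have hα : gP.val (f.toFun x) (η x) (covAlong nablaP f.toFun (f.push (localExtension v)) x X)
      = gP.val (f.toFun x) (η x) (f.secondFundamentalForm nablaP x X v) := by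
    conv_lhs => rw [← f.mfderiv_tangential_add_normal (covAlong nablaP f.toFun _ x X), map_add,
      hn x, zero_add]
    rfl
  have hderiv := hnablaP.mvfderiv_val_along hη (f.mdiffAt_push (mdiffAt_localExtension v)) X
  have hzero : (fun y ↦ gP.val (f.toFun y) (η y) (f.push (localExtension v) y)) = fun _ ↦ 0 :=
    funext fun y ↦ hn y _
  rw [hzero, mvfderiv_const, hα, push, localExtension_self] at hderiv
  have hneg : g.val x (-f.shapeOperator nablaP x (η x) X) v
      = -g.val x (f.shapeOperator nablaP x (η x) X) v := by simp
  rw [val_tangential, hneg, val_shapeOperator]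
  exact eq_neg_of_add_eq_zero_left hderiv.symm

theorem covAlong_eq (f : IsometricImmersion g gP) (hnabla : IsLeviCivita g nabla)
    (hnablaP : IsLeviCivita gP nablaP) {σ : Π y, TangentSpace J (f.toFun y)}
    (hσ : MDiffAlongAt I f.toFun σ x) (X : TangentSpace I x) :
    covAlong nablaP f.toFun σ x X
      = mfderiv I J f.toFun x (nabla (fun y ↦ f.tangential y (σ y)) x X)
        + f.secondFundamentalForm nablaP x X (f.tangential x (σ x))
        + covAlong nablaP f.toFun (fun y ↦ f.normal y (σ y)) x X := by
  have hsum : σ = f.push (fun y ↦ f.tangential y (σ y)) + fun y ↦ f.normal y (σ y) :=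
    funext fun y ↦ (f.mfderiv_tangential_add_normal (σ y)).symm
  have hT := mdiffAt_tangential hσ
  conv_lhs => rw [hsum, covAlong_add nablaP (f.mdiffAt_push hT) (mdiffAlongAt_normal hσ)]
  rw [_root_.add_apply, f.gauss_formula hnabla hnablaP hT]

theorem tangential_covAlong (f : IsometricImmersion g gP) (hnabla : IsLeviCivita g nabla)
    (hnablaP : IsLeviCivita gP nablaP) {σ : Π y, TangentSpace J (f.toFun y)}
    (hσ : MDiffAlongAt I f.toFun σ x) (X : TangentSpace I x) :
    f.tangential x (covAlong nablaP f.toFun σ x X) = nabla (fun y ↦ f.tangential y (σ y)) x X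
      - f.shapeOperator nablaP x (f.normal x (σ x)) X := by
  rw [f.covAlong_eq hnabla hnablaP hσ, map_add, map_add, tangential_mfderiv,
    (f.isNormal_secondFundamentalForm X _).tangential_eq_zero,
    f.weingarten_formula hnablaP (mdiffAlongAt_normal hσ) fun y ↦ f.normal_orthogonal y _,
    add_zero, sub_eq_add_neg]

theorem normal_covAlong (f : IsometricImmersion g gP) (hnabla : IsLeviCivita g nabla)
    (hnablaP : IsLeviCivita gP nablaP) {σ : Π y, TangentSpace J (f.toFun y)}
    (hσ : MDiffAlongAt I f.toFun σ x) (X : TangentSpace I x) :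
    f.normal x (covAlong nablaP f.toFun σ x X)
      = f.secondFundamentalForm nablaP x X (f.tangential x (σ x))
        + f.normalConnection nablaP (fun y ↦ f.normal y (σ y)) x X := by
  rw [f.covAlong_eq hnabla hnablaP hσ, map_add, map_add, normal_mfderiv, zero_add,
    (f.isNormal_secondFundamentalForm X _).normal_eq_self]
  rfl

end IsometricImmersion

end Submanifold

section Product

variable {E : Type*} [NormedAddCommGroup E] [NormedSpace ℝ E]
  {H : Type*} [TopologicalSpace H] {I : ModelWithCorners ℝ E H}
  {M : Type*} [TopologicalSpace M] [ChartedSpace H M] [IsManifold I 1 M]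
  {F : Type*} [NormedAddCommGroup F] [NormedSpace ℝ F]
  {G : Type*} [TopologicalSpace G] {J : ModelWithCorners ℝ F G}
  {P : Type*} [TopologicalSpace P] [ChartedSpace G P] [IsManifold J 1 P]

theorem mem_baseSet_trivializationAt_tangent_prod {p y : M × P} :
    y ∈ (trivializationAt (E × F) (TangentSpace (I.prod J)) p).baseSet
      ↔ y.1 ∈ (trivializationAt E (TangentSpace I) p.1).baseSet
        ∧ y.2 ∈ (trivializationAt F (TangentSpace J) p.2).baseSet := by
  rw [TangentBundle.trivializationAt_baseSet, prodChartedSpace_chartAt]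
  rfl

theorem continuousLinearMapAt_trivializationAt_tangent_prod {p y : M × P}
    (hy : y ∈ (trivializationAt (E × F) (TangentSpace (I.prod J)) p).baseSet)
    (V : TangentSpace (I.prod J) y) :
    (trivializationAt (E × F) (TangentSpace (I.prod J)) p).continuousLinearMapAt ℝ y V
      = ((trivializationAt E (TangentSpace I) p.1).continuousLinearMapAt ℝ y.1 (V : E × F).1,
        (trivializationAt F (TangentSpace J) p.2).continuousLinearMapAt ℝ y.2 (V : E × F).2) := by
  obtain ⟨hy₁, hy₂⟩ := mem_baseSet_trivializationAt_tangent_prod.1 hy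
  rw [TangentBundle.continuousLinearMapAt_trivializationAt hy,
    TangentBundle.continuousLinearMapAt_trivializationAt hy₁,
    TangentBundle.continuousLinearMapAt_trivializationAt hy₂, extChartAt_prod]
  have hfst := (mdifferentiableAt_extChartAt (I := I) hy₁).hasMFDerivAt.comp y
    (hasMFDerivAt_fst (I := I) (I' := J) y)
  have hsnd := (mdifferentiableAt_extChartAt (I := J) hy₂).hasMFDerivAt.comp y
    (hasMFDerivAt_snd (I := I) (I' := J) y)
  have hderiv : HasMFDerivAt (I.prod J) 𝓘(ℝ, E × F)
      ((extChartAt I p.1).prod (extChartAt J p.2)) y _ :=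
    ⟨hfst.1.prodMk hsnd.1, hfst.2.prodMk hsnd.2⟩
  exact DFunLike.congr_fun hderiv.mfderiv V

theorem localExtension_prod {p y : M × P}
    (hy : y ∈ (trivializationAt (E × F) (TangentSpace (I.prod J)) p).baseSet)
    (V : TangentSpace (I.prod J) p) :
    localExtension V y = (localExtension (J := I) (x := p.1) (V : E × F).1 y.1,
      localExtension (J := J) (x := p.2) (V : E × F).2 y.2) := by
  obtain ⟨hy₁, hy₂⟩ := mem_baseSet_trivializationAt_tangent_prod.1 hy
  let t := trivializationAt (E × F) (TangentSpace (I.prod J)) p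
  let W : TangentSpace (I.prod J) y := (localExtension (J := I) (x := p.1) (V : E × F).1 y.1,
    localExtension (J := J) (x := p.2) (V : E × F).2 y.2)
  have hcoords : t.continuousLinearMapAt ℝ y W = t.continuousLinearMapAt ℝ p V := by
    rw [continuousLinearMapAt_trivializationAt_tangent_prod hy,
      continuousLinearMapAt_trivializationAt_tangent_prod (mem_baseSet_trivializationAt' p)]
    exact Prod.ext (Trivialization.continuousLinearMapAt_symmL _ hy₁ _)
      (Trivialization.continuousLinearMapAt_symmL _ hy₂ _)
  rw [localExtension, ← hcoords]
  exact t.symmL_continuousLinearMapAt hy W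

end Product

theorem localExtension_opens {E : Type*} [NormedAddCommGroup E] [NormedSpace ℝ E]
    {S : TopologicalSpace.Opens E} {t : S} (v : TangentSpace 𝓘(ℝ, E) t) (s : S) :
    localExtension v s = v := by
  have hsource (s : S) : s ∈ (chartAt E t).source := by
    simp only [TopologicalSpace.Opens.chartAt_eq, chartAt_self_eq, mfld_simps]
  have hchart (s : S) : HasMFDerivAt 𝓘(ℝ, E) 𝓘(ℝ, E) (extChartAt 𝓘(ℝ, E) t) s
      (ContinuousLinearMap.id ℝ E) := hasMFDerivAt_subtype_val (I := 𝓘(ℝ, E)) s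
  have hcoords (s : S) :
      (trivializationAt E (TangentSpace 𝓘(ℝ, E)) t).continuousLinearMapAt ℝ s
        = ContinuousLinearMap.id ℝ E :=
    (TangentBundle.continuousLinearMapAt_trivializationAt (hsource s)).trans (hchart s).mfderiv
  have hsymm := (trivializationAt E (TangentSpace 𝓘(ℝ, E)) t).symmL_continuousLinearMapAt (R := ℝ)
    (hsource s) (v : E)
  rwa [hcoords, ← hcoords t] at hsymm

section WarpedProduct

variable {F : Type*} [NormedAddCommGroup F] [NormedSpace ℝ F]
  {G : Type*} [TopologicalSpace G] {J : ModelWithCorners ℝ F G}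
  {P : Type*} [TopologicalSpace P] [ChartedSpace G P]
  {S : TopologicalSpace.Opens ℝ} {p : S × P}

theorem mvfderiv_comp_timeCoord_partialT {h : ℝ → ℝ} {h' : ℝ}
    (hh : HasDerivAt h h' (timeCoord S p)) :
    mvfderiv (𝓘(ℝ, ℝ).prod J) (fun y : S × P ↦ h (timeCoord S y)) p (partialT S p) = h' := by
  have hcomp := hh.hasFDerivAt.hasMFDerivAt.comp p (hasMFDerivAt_timeCoord (J := J) S p)
  exact congr($(hcomp.mfderiv) (partialT S p)).trans (one_mul h')

theorem mvfderiv_comp_snd_partialT {k : P → ℝ} (hk : MDiffAt k p.2) :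
    mvfderiv (𝓘(ℝ, ℝ).prod J) (fun y : S × P ↦ k y.2) p (partialT S p) = 0 := by
  have hcomp := hk.hasMFDerivAt.comp p (hasMFDerivAt_snd (I := 𝓘(ℝ, ℝ)) (I' := J) p)
  exact congr($(hcomp.mfderiv) (partialT S p)).trans (map_zero (mfderiv J 𝓘(ℝ, ℝ) k p.2))

variable [IsManifold J ∞ P]

theorem localExtension_warped :
    ∀ᶠ y in 𝓝 p, ∀ V : TangentSpace (𝓘(ℝ, ℝ).prod J) p, localExtension V y
      = ((V : ℝ × F).1, localExtension (J := J) (x := p.2) (V : ℝ × F).2 y.2) :=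
  (eventually_mem_baseSet (J := 𝓘(ℝ, ℝ).prod J) (continuousAt_id (x := p))).mono fun _ hy V ↦
    (localExtension_prod hy V).trans (Prod.ext (localExtension_opens (t := p.1) _ _) rfl)

theorem localExtension_partialT :
    ∀ᶠ y in 𝓝 p, localExtension (partialT (J := J) S p) y = partialT S y := by
  filter_upwards [localExtension_warped (J := J)] with y hy
  have hzero : localExtension (0 : TangentSpace J p.2) = 0 := by ext; simp [localExtension]
  exact (hy _).trans (Prod.ext rfl congr($hzero y.2))

theorem mdiffAt_partialT :
    MDiffAt (T% (partialT (J := J) S : Π q : S × P, TangentSpace (𝓘(ℝ, ℝ).prod J) q)) p :=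
  (mdiffAt_localExtension (partialT (J := J) S p)).congr_of_eventuallyEq <|
    localExtension_partialT.mono fun _ hy ↦ congr(TotalSpace.mk' _ _ $hy.symm)

variable {ε : ℤˣ} {a : ℝ → ℝ} {ha : ContDiffOn ℝ ∞ a S} {hpos : ∀ t ∈ S, 0 < a t}
  {gP : SemiRiemannianMetric J P}

theorem warpedMetric_val (V W : TangentSpace (𝓘(ℝ, ℝ).prod J) p) :
    (warpedMetric ε S a ha hpos gP).val p V W = ((ε : ℤ) : ℝ) * ((V : ℝ × F).1 * (W : ℝ × F).1)
      + a (timeCoord S p) ^ 2 * gP.val p.2 (V : ℝ × F).2 (W : ℝ × F).2 := by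
  simp only [warpedMetric, _root_.add_apply, _root_.smul_apply, pullbackForm_apply,
    ContinuousLinearMap.mul_apply', mvfderiv_timeCoord, mfderiv_snd, smul_eq_mul]
  rfl

theorem warpedMetric_val_partialT (W : TangentSpace (𝓘(ℝ, ℝ).prod J) p) :
    (warpedMetric ε S a ha hpos gP).val p (partialT S p) W = ((ε : ℤ) : ℝ) * (W : ℝ × F).1 := by
  have hzero : gP.val p.2 (0 : F) (W : ℝ × F).2 = 0 := congr($(map_zero (gP.val p.2)) _)
  rw [warpedMetric_val]
  change _ * (1 * _) + _ * gP.val p.2 (0 : F) _ = _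
  rw [hzero, mul_zero, add_zero, one_mul]

theorem mvfderiv_warpedMetric_partialT_left (V W : TangentSpace (𝓘(ℝ, ℝ).prod J) p) :
    mvfderiv (𝓘(ℝ, ℝ).prod J) (fun y ↦ (warpedMetric ε S a ha hpos gP).val y
      (localExtension (partialT S p) y) (localExtension W y)) p V = 0 := by
  have hconst : (fun y ↦ (warpedMetric ε S a ha hpos gP).val y
      (localExtension (partialT S p) y) (localExtension W y)) =ᶠ[𝓝 p]
      fun _ ↦ ((ε : ℤ) : ℝ) * (W : ℝ × F).1 := by
    filter_upwards [localExtension_partialT (J := J), localExtension_warped (J := J)] with y hT hy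
    rw [hT, warpedMetric_val_partialT, hy]
  rw [mvfderiv_congr hconst, mvfderiv_const, _root_.zero_apply]

theorem mvfderiv_warpedMetric_partialT (V W : TangentSpace (𝓘(ℝ, ℝ).prod J) p) :
    mvfderiv (𝓘(ℝ, ℝ).prod J) (fun y ↦ (warpedMetric ε S a ha hpos gP).val y
        (localExtension V y) (localExtension W y)) p (partialT S p)
      = 2 * a (timeCoord S p) * deriv a (timeCoord S p)
        * gP.val p.2 (V : ℝ × F).2 (W : ℝ × F).2 := by
  let v : TangentSpace J p.2 := (V : ℝ × F).2
  let w : TangentSpace J p.2 := (W : ℝ × F).2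
  let k (q : P) : ℝ := gP.val q (localExtension v q) (localExtension w q)
  have hval : (fun y ↦ (warpedMetric ε S a ha hpos gP).val y
      (localExtension V y) (localExtension W y)) =ᶠ[𝓝 p]
      (fun _ ↦ ((ε : ℤ) : ℝ) * ((V : ℝ × F).1 * (W : ℝ × F).1))
        + (fun y : S × P ↦ a (timeCoord S y) ^ 2) • fun y : S × P ↦ k y.2 := by
    filter_upwards [localExtension_warped (J := J)] with y hy
    rw [warpedMetric_val, hy, hy]
    rfl
  have hk : MDiffAt k p.2 := gP.mdifferentiableAt_val_along (f := id)
    (mdiffAt_localExtension v) (mdiffAt_localExtension w)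
  have hkp : k p.2 = gP.val p.2 (V : ℝ × F).2 (W : ℝ × F).2 := by
    simp only [k, localExtension_self]
    rfl
  have hderiv : HasDerivAt (fun t ↦ a t ^ 2) _ (timeCoord S p) :=
    ((ha.contDiffAt (S.isOpen.mem_nhds p.1.2)).differentiableAt (by simp)).hasDerivAt.pow 2
  have hsq : MDiffAt (fun y : S × P ↦ a (timeCoord S y) ^ 2) p :=
    hderiv.differentiableAt.mdifferentiableAt.comp p
      (hasMFDerivAt_timeCoord (J := J) S p).mdifferentiableAt
  have hsnd : MDiffAt (fun y : S × P ↦ k y.2) p := hk.comp p mdifferentiableAt_snd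
  rw [mvfderiv_congr hval, mvfderiv_add mdifferentiableAt_const (hsq.smul hsnd), mvfderiv_const,
    mvfderiv_smul hsq hsnd]
  simp only [zero_add, _root_.add_apply, _root_.smul_apply, ContinuousLinearMap.smulRight_apply,
    mvfderiv_comp_snd_partialT hk, mvfderiv_comp_timeCoord_partialT hderiv, hkp, smul_eq_mul]
  simp [timeCoord]

theorem nabla_partialT {nabla : CovariantDerivative (𝓘(ℝ, ℝ).prod J) (ℝ × F)
      (TangentSpace (𝓘(ℝ, ℝ).prod J) : S × P → Type _)}
    (hnabla : IsLeviCivita (warpedMetric ε S a ha hpos gP) nabla)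
    (V : TangentSpace (𝓘(ℝ, ℝ).prod J) p) :
    nabla (partialT S) p V
      = (deriv a (timeCoord S p) / a (timeCoord S p)) • (V - (V : ℝ × F).1 • partialT S p) := by
  obtain ⟨U, hU, hloc⟩ := (localExtension_partialT (J := J) (p := p)).exists_mem
  have hext : nabla (partialT S) p = nabla (localExtension (partialT S p)) p :=
    nabla.isCovariantDerivativeOn.congr_of_eqOn mdiffAt_partialT (mdiffAt_localExtension _)
      hU fun y hy ↦ (hloc y hy).symm
  refine (warpedMetric ε S a ha hpos gP).eq_of_val_eq fun W ↦ ?_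
  have hLie := hnabla.two_mul_val_localExtension (u := partialT S p) (fun V W ↦ by
    rw [mvfderiv_warpedMetric_partialT_left, mvfderiv_warpedMetric_partialT_left]) V W
  rw [mvfderiv_warpedMetric_partialT, ← hext] at hLie
  have ha0 : a (timeCoord S p) ≠ 0 := (hpos _ p.1.2).ne'
  simp only [map_smul, map_sub, _root_.smul_apply, _root_.sub_apply, warpedMetric_val_partialT,
    smul_eq_mul]
  rw [warpedMetric_val V W]
  field_simp
  linear_combination a (timeCoord S p) * hLie / 2

end WarpedProduct

section Immersion

variable {E : Type*} [NormedAddCommGroup E] [NormedSpace ℝ E]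
  {H : Type*} [TopologicalSpace H] {I : ModelWithCorners ℝ E H}
  {M : Type*} [TopologicalSpace M] [ChartedSpace H M] [IsManifold I ∞ M]
  {F : Type*} [NormedAddCommGroup F] [NormedSpace ℝ F]
  {G : Type*} [TopologicalSpace G] {J : ModelWithCorners ℝ F G}
  {P : Type*} [TopologicalSpace P] [ChartedSpace G P] [IsManifold J ∞ P]
  {ε : ℤˣ} {S : TopologicalSpace.Opens ℝ} {a : ℝ → ℝ} {ha : ContDiffOn ℝ ∞ a S}
  {hpos : ∀ t ∈ S, 0 < a t} {g : SemiRiemannianMetric I M} {gP : SemiRiemannianMetric J P}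

namespace IsometricImmersion

theorem mvfderiv_timeCoord_comp (f : IsometricImmersion g (warpedMetric ε S a ha hpos gP)) (x : M)
    (v : TangentSpace I x) : mvfderiv I (fun y ↦ timeCoord S (f.toFun y)) x v
      = (mfderiv I (𝓘(ℝ, ℝ).prod J) f.toFun x v : ℝ × F).1 :=
  congr($(((hasMFDerivAt_timeCoord S (f.toFun x)).comp x
    ((f.contMDiff x).mdifferentiableAt (by simp)).hasMFDerivAt).mfderiv) v)

variable [FiniteDimensional ℝ E]

theorem tangential_partialT (f : IsometricImmersion g (warpedMetric ε S a ha hpos gP)) (x : M) :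
    f.tangential x (partialT S (f.toFun x))
      = ((ε : ℤ) : ℝ) • g.grad (fun y ↦ timeCoord S (f.toFun y)) x := by
  refine g.eq_of_val_eq fun v ↦ ?_
  rw [val_tangential, warpedMetric_val_partialT, ← mvfderiv_timeCoord_comp, map_smul,
    _root_.smul_apply, SemiRiemannianMetric.grad, g.val_sharp]
  rfl

theorem val_tangential_partialT (f : IsometricImmersion g (warpedMetric ε S a ha hpos gP)) (x : M)
    (v : TangentSpace I x) :
    ((ε : ℤ) : ℝ) * g.val x v (f.tangential x (partialT S (f.toFun x)))
      = (mfderiv I (𝓘(ℝ, ℝ).prod J) f.toFun x v : ℝ × F).1 := by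
  rw [g.symm, val_tangential, warpedMetric_val_partialT, ← mul_assoc, Quadric.coe_mul_self, one_mul]

end IsometricImmersion

theorem lemma3p1_general [FiniteDimensional ℝ E] [FiniteDimensional ℝ F]
    (f : IsometricImmersion g (warpedMetric ε S a ha hpos gP))
    {nabla : CovariantDerivative I E (TangentSpace I : M → Type _)} (hnabla : IsLeviCivita g nabla)
    {nablaBar : CovariantDerivative (𝓘(ℝ, ℝ).prod J) (ℝ × F)
      (TangentSpace (𝓘(ℝ, ℝ).prod J) : S × P → Type _)}
    (hnablaBar : IsLeviCivita (warpedMetric ε S a ha hpos gP) nablaBar)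
    {pr : M → ℝ} (hpr : pr = fun x ↦ timeCoord S (f.toFun x))
    {T : Π x : M, TangentSpace I x} (hT : T = fun x ↦ ((ε : ℤ) : ℝ) • g.grad pr x)
    {ξ : Π x : M, TangentSpace (𝓘(ℝ, ℝ).prod J) (f.toFun x)}
    (hξ : ∀ x, partialT S (f.toFun x) = mfderiv I (𝓘(ℝ, ℝ).prod J) f.toFun x (T x) + ξ x)
    (x : M) (X : TangentSpace I x) :
    f.IsNormal x (ξ x) ∧
    nablaBar (partialT S) (f.toFun x) (mfderiv I (𝓘(ℝ, ℝ).prod J) f.toFun x X)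
      = (deriv a (pr x) / a (pr x)) •
        (mfderiv I (𝓘(ℝ, ℝ).prod J) f.toFun x X
          - (((ε : ℤ) : ℝ) * g.val x X (T x)) • partialT S (f.toFun x)) ∧
    nabla T x X
      = (deriv a (pr x) / a (pr x)) • (X - (((ε : ℤ) : ℝ) * g.val x X (T x)) • T x)
        + f.shapeOperator nablaBar x (ξ x) X ∧
    f.normalConnection nablaBar ξ x X
      = -(((ε : ℤ) : ℝ) * deriv a (pr x) / a (pr x) * g.val x X (T x)) • ξ x
        - f.secondFundamentalForm nablaBar x X (T x) := by
  have hT' : T = fun y ↦ f.tangential y (partialT S (f.toFun y)) := by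
    ext y; rw [hT, hpr, f.tangential_partialT]
  have hξ' : ξ = fun y ↦ f.normal y (partialT S (f.toFun y)) := funext fun y ↦ by
    rw [← add_right_inj, ← hξ, hT', f.mfderiv_tangential_add_normal]
  subst hT' hξ' hpr
  have hbar := nabla_partialT hnablaBar (mfderiv I (𝓘(ℝ, ℝ).prod J) f.toFun x X)
  rw [← f.val_tangential_partialT] at hbar
  have hf : MDiffAt f.toFun x := (f.contMDiff x).mdifferentiableAt (by simp)
  have hσ : MDiffAlongAt I f.toFun (fun y ↦ partialT (J := J) S (f.toFun y)) x :=
    mdiffAt_partialT.comp x hf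
  have hcov := congr($(covAlong_comp nablaBar hf mdiffAt_partialT) X).trans hbar
  have htan := f.tangential_covAlong hnabla hnablaBar hσ X
  have hnor := f.normal_covAlong hnabla hnablaBar hσ X
  rw [hcov] at htan hnor
  simp only [map_smul, map_sub, f.tangential_mfderiv, f.normal_mfderiv, zero_sub] at htan hnor
  refine ⟨f.normal_orthogonal x _, hbar, ?_, ?_⟩
  · exact eq_add_of_sub_eq htan.symm
  · rw [eq_sub_iff_add_eq', ← hnor, smul_neg, smul_smul, ← neg_smul]
    congr 1
    ring

end Immersion

theorem lemma3p1 {n N l : ℕ} (hN : 2 ≤ N) (hl : l ≤ N) (c ε : ℤˣ) (p₀ : Quadric N l c)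
    (S : TopologicalSpace.Opens ℝ) (hS : IsPreconnected (S : Set ℝ))
    (a : ℝ → ℝ) (ha : ContDiffOn ℝ ∞ a S) (hpos : ∀ t ∈ S, 0 < a t)
    {M : Type*} [TopologicalSpace M] [ChartedSpace (EuclideanSpace ℝ (Fin n)) M]
    [IsManifold (𝓡 n) ∞ M] [T2Space M] [SecondCountableTopology M] [ConnectedSpace M]
    (g : SemiRiemannianMetric (𝓡 n) M)
    (f : IsometricImmersion g (warpedMetric ε S a ha hpos (SpaceForm.metric p₀)))
    (nabla : CovariantDerivative (𝓡 n) (EuclideanSpace ℝ (Fin n))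
      (TangentSpace (𝓡 n) : M → Type _))
    (hnabla : IsLeviCivita g nabla)
    (nablaBar : CovariantDerivative (𝓘(ℝ, ℝ).prod (𝓡 N)) (ℝ × EuclideanSpace ℝ (Fin N))
      (TangentSpace (𝓘(ℝ, ℝ).prod (𝓡 N)) : S × SpaceForm p₀ → Type _))
    (hnablaBar : IsLeviCivita (warpedMetric ε S a ha hpos (SpaceForm.metric p₀)) nablaBar)
    (pr : M → ℝ) (hpr : pr = fun x ↦ timeCoord S (f.toFun x))
    (T : Π x : M, TangentSpace (𝓡 n) x) (hT : T = fun x ↦ ((ε : ℤ) : ℝ) • g.grad pr x)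
    (ξ : Π x : M, TangentSpace (𝓘(ℝ, ℝ).prod (𝓡 N)) (f.toFun x))
    (hξ : ∀ x, partialT S (f.toFun x) = mfderiv (𝓡 n) (𝓘(ℝ, ℝ).prod (𝓡 N)) f.toFun x (T x) + ξ x)
    (x : M) (X : TangentSpace (𝓡 n) x) :
    f.IsNormal x (ξ x) ∧
    nablaBar (partialT S) (f.toFun x) (mfderiv (𝓡 n) (𝓘(ℝ, ℝ).prod (𝓡 N)) f.toFun x X)
      = (deriv a (pr x) / a (pr x)) •
        (mfderiv (𝓡 n) (𝓘(ℝ, ℝ).prod (𝓡 N)) f.toFun x X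
          - (((ε : ℤ) : ℝ) * g.val x X (T x)) • partialT S (f.toFun x)) ∧
    nabla T x X
      = (deriv a (pr x) / a (pr x)) • (X - (((ε : ℤ) : ℝ) * g.val x X (T x)) • T x)
        + f.shapeOperator nablaBar x (ξ x) X ∧
    f.normalConnection nablaBar ξ x X
      = -(((ε : ℤ) : ℝ) * deriv a (pr x) / a (pr x) * g.val x X (T x)) • ξ x
        - f.secondFundamentalForm nablaBar x X (T x) :=
  lemma3p1_general f hnabla hnablaBar hpr hT hξ x X
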